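/- Let $N\ge 2$. Consider the standard Bell scenario with $N$ parties, inputs $x_i\in\{0,1\}$ and outputs $a_i\in\{0,1\}$. A behaviour $p(\vec a|\vec x)$ has correlators $\langle A^{(1)}_{x_1}\cdots A^{(N)}_{x_N}\rangle=\sum_{\sum_i a_i\text{ even}}p(\vec a|\vec x)-\sum_{\sum_i a_i\text{ odd}}p(\vec a|\vec x)$, and $$S_N^{\pm}=\sum_{\vec x\in\{0,1\}^N}(-1)^{w_{\vec x}(w_{\vec x}\pm1)/2}\,\langle A^{(1)}_{x_1}\cdots A^{(N)}_{x_N}\rangle ,$$ where $w_{\vec x}$ is the Hamming weight of $\vec x$. A realization of $p$ consists of Hilbert spaces $H_1,\dots,H_N,H_P$ of arbitrary dimension, a unit vector $|\psi\rangle\in H_1\otimes\cdots\otimes H_N\otimes H_P$ (a purification of the shared state) and POVMs $\{\Pi^{(i)}_{0|x},\Pi^{(i)}_{1|x}\}$ on $H_i$ with $p(\vec a|\vec x)=\langle\psi|\bigotimes_i\Pi^{(i)}_{a_i|x_i}\otimes 1_P|\psi\rangle$; put $A^{(i)}_x=\Pi^{(i)}_{0|x}-\Pi^{(i)}_{1|x}$.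 A behaviour is quantum if it has a realization. A behaviour self-tests an $N$-qubit state $|\Phi\rangle$ and qubit observables $\bar A^{(i)}_x$ if for each of its realizations there are Hilbert spaces $K_i$, isometries $\Lambda_i:H_i\to\mathbb C^2\otimes K_i$ and a unit vector $|\zeta\rangle\in K_1\otimes\cdots\otimes K_N\otimes H_P$ such that, with $\Lambda=\Lambda_1\otimes\cdots\otimes\Lambda_N\otimes 1_P$, $$\Lambda|\psi\rangle=|\Phi\rangle\otimes|\zeta\rangle,\qquad \Lambda\Big(\bigotimes_i A^{(i)}_{x_i}\otimes 1_P\,|\psi\rangle\Big)=\Big(\bigotimes_i\bar A^{(i)}_{x_i}|\Phi\rangle\Big)\otimes|\zeta\rangle\quad\text{for all }\vec x .$$ Let $s\in\{1,-1\}$ and write $S_N^{s}$ for $S_N^{+}$ if $s=1$ and $S_N^-$ if $s=-1$. Every quantum behaviour satisfies $|S_N^{s}|\le 2^{N-1}\sqrt2$. Let $\varepsilon\in\{1,-1\}$. Let $|\mathrm{GHZ}\rangle=(|0\cdots0\rangle+|1\cdots1\rangle)/\sqrt2$ and $$\bar A^{(1)}_0=\varepsilon\,\tfrac{\sigma_x+\sigma_y}{\sqrt2},\quad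 \bar A^{(1)}_1=s\,\varepsilon\,\tfrac{\sigma_y-\sigma_x}{\sqrt2},\qquad \bar A^{(i)}_0=\sigma_x,\quad \bar A^{(i)}_1=s\,\sigma_y\quad(2\le i\le N).$$ The (quantum) behaviour obtained by measuring these observables on $|\mathrm{GHZ}\rangle$ has $S_N^{s}=\varepsilon\,2^{N-1}\sqrt2$. Conversely, every behaviour $p$ with $S_N^{s}=\varepsilon\,2^{N-1}\sqrt2$ self-tests $|\mathrm{GHZ}\rangle$ and these observables. It also self-tests the fully connected graph state $2^{-N/2}\sum_{\tau\in\{0,1\}^N}(-1)^{\binom{w_\tau}{2}}|\tau\rangle$, which is locally unitarily equivalent to $|\mathrm{GHZ}\rangle$, together with the observables $\varepsilon\frac{\sigma_x-\sigma_z}{\sqrt2},\,-s\,\varepsilon\frac{\sigma_x+\sigma_z}{\sqrt2}$ of the first party and $\sigma_z,\,s\,\sigma_x$ of every other party. -/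

import Mathlib

/-!
Self-testing in the `N`-partite Bell scenario with binary inputs and outputs.

Every Hilbert space is, up to a choice of an orthonormal basis, the space `ℓ²(ι)` of
square-summable families indexed by some type `ι`. The Hilbert space tensor product of the
`ℓ²(ι i)` and of `ℓ²(P)` is then `ℓ²((∀ i, ι i) × P)`, with no restriction on dimensions.
-/

universe u

noncomputable section

namespace SvetlichnySelfTest

open scoped ComplexConjugate Matrix

/-- The Hilbert space `ℓ²(ι)`. -/
abbrev Ell2 (ι : Type u) : Type u := lp (fun _ : ι => ℂ) 2

open Classical in
/-- The matrix element `⟨e_g, A e_f⟩` of a bounded operator between `ℓ²` spaces. -/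
def matElem {ι κ : Type u} (A : Ell2 ι →L[ℂ] Ell2 κ) (g : κ) (f : ι) : ℂ :=
  A (lp.single 2 f (1 : ℂ)) g

/-- The action of the tensor product operator `A₁ ⊗ ⋯ ⊗ A_N ⊗ 1_P` on a vector, by coordinates:
`(A ψ)(g, q) = ∑_f (∏ i, ⟨e_{g i}, A_i e_{f i}⟩) ψ(f, q)`.
For square-summable `ψ` the series converges absolutely, because each row of a bounded operator
is square-summable and so is a finite product of such rows, and the result is the vector of
coordinates of the Hilbert space tensor product operator applied to `ψ`. -/
def tensorApply {N : ℕ} {ι κ : Fin N → Type u} {P : Type u}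
    (A : ∀ i, Ell2 (ι i) →L[ℂ] Ell2 (κ i)) (ψ : (∀ i, ι i) × P → ℂ) :
    (∀ i, κ i) × P → ℂ :=
  fun z => ∑' f : ∀ i, ι i, (∏ i, matElem (A i) (z.1 i) (f i)) * ψ (f, z.2)

/-- A string of `N` bits. -/
abbrev Bits (N : ℕ) : Type := Fin N → Fin 2

/-- The Hamming weight of a string of bits. -/
def weight {N : ℕ} (x : Bits N) : ℕ := ∑ i, (x i : ℕ)

/-- A family `p a x`, to be read as `p(a|x)`: outputs `a` given inputs `x`. -/
abbrev Behaviour (N : ℕ) : Type := Bits N → Bits N → ℝ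

/-- The correlator at input `x`: even parity outputs minus odd parity outputs. -/
def correlator {N : ℕ} (p : Behaviour N) (x : Bits N) : ℝ :=
  (∑ a : Bits N with weight a % 2 = 0, p a x) - ∑ a : Bits N with weight a % 2 = 1, p a x

/-- The Svetlichny expression `S_N^+` (for `s = 1`) and `S_N^-` (for `s = -1`). The exponent
`w (w + s) / 2` is an integer, as `w (w ± 1)` is even. -/
def svetlichny {N : ℕ} (s : ℤˣ) (p : Behaviour N) : ℝ :=
  ∑ x : Bits N,
    (-1 : ℝ) ^ (((weight x : ℤ) * ((weight x : ℤ) + (s : ℤ))) / 2) * correlator p x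

/-- A quantum realization of the standard Bell scenario: local Hilbert spaces `ℓ²(ι i)`, a shared
state given by a purification `ψ` with purifying system `ℓ²(P)` (on which nobody acts), and for
each party `i` and each input `x` a two-outcome POVM `E i x 0, E i x 1`. -/
structure Realization (N : ℕ) : Type (u + 1) where
  /-- the orthonormal basis labels of the local Hilbert spaces -/
  ι : Fin N → Type u
  /-- the orthonormal basis labels of the purifying system -/
  P : Type u
  /-- the purification of the shared state -/
  ψ : Ell2 ((∀ i, ι i) × P)
  norm_ψ : ‖ψ‖ = 1
  /-- `E i x a` is the POVM element of party `i` for input `x` and output `a` -/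
  E : ∀ i, Fin 2 → Fin 2 → (Ell2 (ι i) →L[ℂ] Ell2 (ι i))
  E_pos : ∀ i x a, (E i x a).IsPositive
  E_sum : ∀ i x, E i x 0 + E i x 1 = 1

/-- The binary observable of party `i` for input `x`. -/
def Realization.obs {N : ℕ} (R : Realization.{u} N) (i : Fin N) (x : Fin 2) :
    Ell2 (R.ι i) →L[ℂ] Ell2 (R.ι i) :=
  R.E i x 0 - R.E i x 1

/-- The realization is compatible with `p`, by the Born rule
`p(a|x) = ⟨ψ, E_{a₁|x₁} ⊗ ⋯ ⊗ E_{a_N|x_N} ⊗ 1_P ψ⟩`. -/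
def Realization.Compatible {N : ℕ} (R : Realization.{u} N) (p : Behaviour N) : Prop :=
  ∀ a x : Bits N, (p a x : ℂ) =
    ∑' z : (∀ i, R.ι i) × R.P,
      conj (R.ψ z) * tensorApply (fun i => R.E i (x i) (a i)) (R.ψ) z

/-- `p` is a quantum behaviour. -/
def IsQuantum {N : ℕ} (p : Behaviour N) : Prop :=
  ∃ R : Realization.{u} N, R.Compatible p

/-- A vector of `N` qubits, by its coordinates in the computational basis. -/
abbrev Qubits (N : ℕ) : Type := Bits N → ℂ

/-- The action of a tensor product of `2 × 2` matrices on `N` qubits. -/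
def qubitApply {N : ℕ} (B : Fin N → Matrix (Fin 2) (Fin 2) ℂ) (Φ : Qubits N) : Qubits N :=
  fun g => ∑ f : Bits N, (∏ i, B i (g i) (f i)) * Φ f

/-- The behaviour `p` self-tests the state `Φ` of `N` qubits together with the target observables
`B i x`: for every realization compatible with `p` there are local isometries
`Λ i : ℓ²(ι i) → ℂ² ⊗ ℓ²(κ i)` and a unit vector `ζ` of the remaining degrees of freedom with
`Λ ψ = Φ ⊗ ζ`, and `Λ (A_{x₁} ⊗ ⋯ ⊗ A_{x_N} ψ) = (B_{x₁} ⊗ ⋯ ⊗ B_{x_N} Φ) ⊗ ζ` for all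
inputs `x`. -/
def SelfTests {N : ℕ} (p : Behaviour N) (Φ : Qubits N)
    (B : Fin N → Fin 2 → Matrix (Fin 2) (Fin 2) ℂ) : Prop :=
  ∀ R : Realization.{u} N, R.Compatible p →
    ∃ (κ : Fin N → Type u) (Λ : ∀ i, Ell2 (R.ι i) →ₗᵢ[ℂ] Ell2 (Fin 2 × κ i))
      (ζ : Ell2 ((∀ i, κ i) × R.P)), ‖ζ‖ = 1 ∧
      (∀ (g : ∀ i, Fin 2 × κ i) (q : R.P),
        tensorApply (fun i => (Λ i).toContinuousLinearMap) (R.ψ) (g, q) =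
          Φ (fun i => (g i).1) * ζ (fun i => (g i).2, q)) ∧
      ∀ (x : Bits N) (g : ∀ i, Fin 2 × κ i) (q : R.P),
        tensorApply (fun i => (Λ i).toContinuousLinearMap)
            (tensorApply (fun i => R.obs i (x i)) (R.ψ)) (g, q) =
          qubitApply (fun i => B i (x i)) Φ (fun i => (g i).1) * ζ (fun i => (g i).2, q)

/-- The behaviour of the reference experiment: the observables `B i x` (with outcome projections
`(1 + (-1)^a B i x) / 2`) measured on the state `Φ`. -/
def refBehaviour {N : ℕ} (Φ : Qubits N) (B : Fin N → Fin 2 → Matrix (Fin 2) (Fin 2) ℂ) :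
    Behaviour N :=
  fun a x => (∑ g : Bits N, conj (Φ g) *
    qubitApply (fun i => (1 / 2 : ℂ) • (1 + (-1 : ℂ) ^ (a i : ℕ) • B i (x i))) Φ g).re

/-- The Pauli matrix `σ_x`. -/
def σx : Matrix (Fin 2) (Fin 2) ℂ := !![0, 1; 1, 0]

/-- The Pauli matrix `σ_y`. -/
def σy : Matrix (Fin 2) (Fin 2) ℂ := !![0, -Complex.I; Complex.I, 0]

/-- The Pauli matrix `σ_z`. -/
def σz : Matrix (Fin 2) (Fin 2) ℂ := !![1, 0; 0, -1]

/-- The GHZ state `(|0⋯0⟩ + |1⋯1⟩) / √2`. -/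
def ghz (N : ℕ) : Qubits N :=
  fun τ => ((if ∀ i, τ i = 0 then 1 else 0) + (if ∀ i, τ i = 1 then 1 else 0)) / (√2 : ℝ)

/-- The fully connected graph state `2^{-N/2} ∑_τ (-1)^{n(τ)} |τ⟩`, where `n(τ)` is the number of
edges between qubits that are in state `1`. -/
def graphState (N : ℕ) : Qubits N :=
  fun τ => (-1 : ℂ) ^ (weight τ).choose 2 / (√(2 ^ N) : ℝ)

/-- The sign with which the `S_N^+` observable of party `i` for input `x` enters the target for
`S_N^s` and the extremal value `ε 2^{N-1} √2`: every observable for input `1` changes sign when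
`s = -1`, both observables of the first party change sign when `ε = -1`. -/
def targetSign {N : ℕ} (s ε : ℤˣ) (i : Fin N) (x : Fin 2) : ℂ :=
  ((s : ℤ) : ℂ) ^ (x : ℕ) * (if (i : ℕ) = 0 then ((ε : ℤ) : ℂ) else 1)

/-- The target observables on the GHZ state. For `s = ε = 1` they are
`(σ_x + σ_y)/√2, (σ_y - σ_x)/√2` for the first party and `σ_x, σ_y` for every other party. -/
def ghzObs {N : ℕ} (s ε : ℤˣ) (i : Fin N) (x : Fin 2) : Matrix (Fin 2) (Fin 2) ℂ :=
  targetSign s ε i x •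
    (if (i : ℕ) = 0 then
      ((1 / √2 : ℝ) : ℂ) • (if x = 0 then σx + σy else σy - σx)
    else if x = 0 then σx else σy)

/-- The target observables on the graph state. For `s = ε = 1` they are
`(σ_x - σ_z)/√2, -(σ_x + σ_z)/√2` for the first party and `σ_z, σ_x` for every other party. -/
def graphObs {N : ℕ} (s ε : ℤˣ) (i : Fin N) (x : Fin 2) : Matrix (Fin 2) (Fin 2) ℂ :=
  targetSign s ε i x •
    (if (i : ℕ) = 0 then
      ((1 / √2 : ℝ) : ℂ) • (if x = 0 then σx - σz else -(σx + σz))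
    else if x = 0 then σz else σx)

end SvetlichnySelfTest

end

/-! The argument is a sum-of-squares certificate followed by an exact extraction of a qubit from
each party. Multiplying the observables by `targetSign` turns every case into `s = ε = 1`. Write `a
0`, `a 1` for the first party's observables applied to `ψ`, and `m x` for the product of the other
parties' observables applied to `ψ`. Up to the factor `2 * √2`, the gap between `2 ^ n * √2` and the
Svetlichny value is a sum of the squares `‖± a 0 ± a 1 - √2 m x‖ ^ 2` and of the defects `1 - ‖a x‖
^ 2`, `1 - ‖m x‖ ^ 2` (`svetlichny_sum_of_squares`). The cross terms in `⟪a 0, a 1⟫` carry the sign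
`(-1) ^ (weight x + 1)` and cancel. This gives the bound.

At the maximum every square vanishes. Vanishing defects make each observable an involution on `ψ`.
Hence the first party's normalized difference `X` and sum `Y` anticommute on `ψ`, and the strings of
weight 0 and 1 identify `X ψ` and `-Y ψ` with products of the other parties' observables. Since
different parties commute, `relations_of_correlated` transfers the Pauli relations to every party.
Moreover `X ⊗ ⋯ ⊗ X` fixes `ψ`, and `X Y ψ` (which is `i Z ψ`) is the same vector for all parties:
these are the stabilizer relations of the GHZ state.

For each party, `X` and `Y` are genuine Pauli operators on a closed invariant subspace, and
`exists_pauli_components` gives the two components of an isometry that splits off a qubit. The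
stabilizer relations then kill every component of `ψ` outside the strings `0⋯0` and `1⋯1` and equate
those two (`exists_ghz_components`). Each observable is a linear combination of `X` and `Y`, so its
action follows by multilinearity. The graph state version is the same isometry followed by a local
unitary (`selfTests_of_frame`).

Attainment is a direct computation: only the two off-diagonal corner entries contribute to a GHZ
correlator. -/

noncomputable section

namespace SvetlichnySelfTest

open scoped ComplexConjugate InnerProductSpace Matrix

/-! ### Amplification of an operator to a tensor product with the identity. -/

section Amplify

variable {β κ γ : Type u}

/-- The part of a vector of `ℓ²(γ) ≃ ℓ²(β × κ)` over a fixed first coordinate. -/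
def slice (e : β × κ ≃ γ) (b : β) : Ell2 γ →ₗ[ℂ] Ell2 κ where
  toFun φ := ⟨fun k => φ (e (b, k)), by
    have h := (lp.memℓp φ).summable (by simp)
    refine memℓp_gen ?_
    exact h.comp_injective (i := fun k => e (b, k)) fun k l hkl => by simpa using hkl⟩
  map_add' _ _ := rfl
  map_smul' _ _ := rfl

@[simp]
theorem slice_apply (e : β × κ ≃ γ) (b : β) (φ : Ell2 γ) (k : κ) :
    slice e b φ k = φ (e (b, k)) := rfl

theorem ext_slice (e : β × κ ≃ γ) {φ φ' : Ell2 γ} (h : ∀ b, slice e b φ = slice e b φ') :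
    φ = φ' := by
  ext z
  obtain ⟨⟨b, k⟩, rfl⟩ := e.surjective z
  rw [← slice_apply, h, slice_apply]

theorem hasSum_inner_slice (e : β × κ ≃ γ) (φ φ' : Ell2 γ) :
    HasSum (fun b => ⟪slice e b φ, slice e b φ'⟫_ℂ) ⟪φ, φ'⟫_ℂ := by
  have h := (e.hasSum_iff).2 (lp.hasSum_inner (𝕜 := ℂ) φ φ')
  exact h.prod_fiberwise fun b => lp.hasSum_inner (𝕜 := ℂ) (slice e b φ) (slice e b φ')

theorem hasSum_norm_slice (e : β × κ ≃ γ) (φ : Ell2 γ) :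
    HasSum (fun b => ‖slice e b φ‖ ^ 2) (‖φ‖ ^ 2) := by
  have h := Complex.hasSum_re (hasSum_inner_slice e φ φ)
  simpa only [← RCLike.re_eq_complex_re, inner_self_eq_norm_sq] using h

theorem hasSum_norm_sq (φ : Ell2 κ) : HasSum (fun k => ‖φ k‖ ^ 2) (‖φ‖ ^ 2) := by
  have h := Complex.hasSum_re (lp.hasSum_inner (𝕜 := ℂ) φ φ)
  simpa only [← RCLike.re_eq_complex_re, inner_self_eq_norm_sq] using h

theorem memℓp_two_of_summable {f : κ → ℂ} (h : Summable fun k => ‖f k‖ ^ 2) :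
    Memℓp f 2 := by
  refine memℓp_gen ?_
  simpa using h

/-- The slices of `φ` have square-summable norms, and applying `A` slicewise enlarges each norm by
at most the factor `‖A‖`. -/
theorem memℓp_amplify (e : β × κ ≃ γ) (A : Ell2 κ →L[ℂ] Ell2 κ) (φ : Ell2 γ) :
    Memℓp (fun z => A (slice e (e.symm z).1 φ) (e.symm z).2) 2 := by
  refine memℓp_two_of_summable ?_
  rw [← e.summable_iff]
  refine (summable_prod_of_nonneg fun _ => by simp only [Function.comp, Pi.zero_apply]; positivity).2 ⟨fun b => ?_, ?_⟩
  · simpa using (hasSum_norm_sq (A (slice e b φ))).summable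
  · refine Summable.of_nonneg_of_le (fun b => tsum_nonneg fun _ => by simp only [Function.comp]; positivity) (fun b => ?_)
      ((hasSum_norm_slice e φ).summable.mul_left (‖A‖ ^ 2))
    have := (hasSum_norm_sq (A (slice e b φ))).tsum_eq
    simp only [Function.comp, Equiv.symm_apply_apply]
    rw [this, ← mul_pow]
    gcongr
    exact A.le_opNorm _

/-- `1 ⊗ A` as a linear map. -/
def amplifyLinear (e : β × κ ≃ γ) (A : Ell2 κ →L[ℂ] Ell2 κ) : Ell2 γ →ₗ[ℂ] Ell2 γ where
  toFun φ := ⟨_, memℓp_amplify e A φ⟩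
  map_add' φ φ' := by ext z; simp; rfl
  map_smul' c φ := by ext z; simp

theorem slice_amplifyLinear (e : β × κ ≃ γ) (A : Ell2 κ →L[ℂ] Ell2 κ) (b : β) (φ : Ell2 γ) :
    slice e b (amplifyLinear e A φ) = A (slice e b φ) := by
  ext k
  simp [amplifyLinear]

/-- `1 ⊗ A` as a bounded operator. -/
def amplifyCLM (e : β × κ ≃ γ) (A : Ell2 κ →L[ℂ] Ell2 κ) : Ell2 γ →L[ℂ] Ell2 γ :=
  (amplifyLinear e A).mkContinuous ‖A‖ fun φ => by
    refine le_of_sq_le_sq ?_ (by positivity)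
    rw [mul_pow]
    refine hasSum_le (fun b => ?_) (hasSum_norm_slice e _)
      ((hasSum_norm_slice e φ).mul_left (‖A‖ ^ 2))
    rw [slice_amplifyLinear, ← mul_pow]
    gcongr
    exact A.le_opNorm _

theorem slice_amplifyCLM (e : β × κ ≃ γ) (A : Ell2 κ →L[ℂ] Ell2 κ) (b : β) (φ : Ell2 γ) :
    slice e b (amplifyCLM e A φ) = A (slice e b φ) := slice_amplifyLinear e A b φ

/-- The amplification `A ↦ 1 ⊗ A`. -/
def amplify (e : β × κ ≃ γ) : (Ell2 κ →L[ℂ] Ell2 κ) →⋆ₐ[ℂ] (Ell2 γ →L[ℂ] Ell2 γ) where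
  toFun := amplifyCLM e
  map_one' := by
    ext1 φ; exact ext_slice e fun b => by simp [slice_amplifyCLM]
  map_mul' A B := by
    ext1 φ; exact ext_slice e fun b => by simp [slice_amplifyCLM]
  map_zero' := by
    ext1 φ; exact ext_slice e fun b => by simp [slice_amplifyCLM]
  map_add' A B := by
    ext1 φ; exact ext_slice e fun b => by simp [slice_amplifyCLM]
  commutes' c := by
    ext1 φ; exact ext_slice e fun b => by simp [slice_amplifyCLM, Algebra.algebraMap_eq_smul_one]
  map_star' A := by
    simp only [ContinuousLinearMap.star_eq_adjoint]
    rw [ContinuousLinearMap.eq_adjoint_iff]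
    intro φ φ'
    refine (hasSum_inner_slice e _ _).unique ?_
    convert! hasSum_inner_slice e φ (amplifyCLM e A φ') using 2 with b
    simp [slice_amplifyCLM, ContinuousLinearMap.adjoint_inner_left]

@[simp]
theorem slice_amplify (e : β × κ ≃ γ) (A : Ell2 κ →L[ℂ] Ell2 κ) (b : β) (φ : Ell2 γ) :
    slice e b (amplify e A φ) = A (slice e b φ) := slice_amplifyLinear e A b φ

end Amplify

/-! ### Tensor products of local operators as bounded operators. -/

section TensorOp

variable {N : ℕ} {ι : Fin N → Type u} {P : Type u}

/-- The splitting of the labels of the product basis into those of party `i` and the rest. -/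
def splitEquiv (ι : Fin N → Type u) (P : Type u) (i : Fin N) :
    ((∀ j : {j // j ≠ i}, ι j) × P) × ι i ≃ (∀ j, ι j) × P :=
  (Equiv.prodAssoc _ _ _).trans <| (Equiv.prodCongrRight fun _ => Equiv.prodComm _ _).trans <|
    (Equiv.prodAssoc _ _ _).symm.trans <|
      (Equiv.prodComm _ _ |>.trans (Equiv.piSplitAt i ι).symm).prodCongr (Equiv.refl P)

theorem splitEquiv_apply (i : Fin N) (f : ∀ j, ι j) (q : P) (k : ι i) :
    splitEquiv ι P i ((fun j => f j, q), k) = (Function.update f i k, q) := by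
  simp only [splitEquiv, Equiv.piSplitAt]
  refine Prod.ext (funext fun j => ?_) rfl
  by_cases h : j = i
  · subst h; simp
  · simp [h]

theorem splitEquiv_apply_self (i : Fin N) (f : ∀ j, ι j) (q : P) :
    splitEquiv ι P i ((fun j => f j, q), f i) = (f, q) := by
  rw [splitEquiv_apply, Function.update_eq_self]

/-- The operator `1 ⊗ ⋯ ⊗ A ⊗ ⋯ ⊗ 1` with `A` acting on party `i`. -/
def localOp (i : Fin N) :
    (Ell2 (ι i) →L[ℂ] Ell2 (ι i)) →⋆ₐ[ℂ]
      (Ell2 ((∀ i, ι i) × P) →L[ℂ] Ell2 ((∀ i, ι i) × P)) :=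
  amplify (splitEquiv ι P i)

theorem localOp_apply (i : Fin N) (A : Ell2 (ι i) →L[ℂ] Ell2 (ι i)) (φ : Ell2 ((∀ i, ι i) × P))
    (f : ∀ i, ι i) (q : P) :
    localOp i A φ (f, q) = A (slice (splitEquiv ι P i) (fun j => f j, q) φ) (f i) := by
  rw [← slice_amplify, slice_apply, splitEquiv_apply_self]; rfl

theorem coe_single_one {κ : Type u} {_ : DecidableEq κ} (f g : κ) {dec : Decidable (g = f)} :
    lp.single (E := fun _ : κ => ℂ) 2 f (1 : ℂ) g = if g = f then 1 else 0 := by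
  rw [lp.single_apply, Pi.single_apply]
  congr

-- Matrix elements are computed with this: when `φ` is itself an operator applied to a basis vector,
-- its slice for party `i` is a multiple of a basis vector.
open Classical in
theorem localOp_apply_of_slice (i : Fin N) (A : Ell2 (ι i) →L[ℂ] Ell2 (ι i))
    (φ : Ell2 ((∀ i, ι i) × P)) (g : ∀ i, ι i) (q : P) (l : ι i) (c : ℂ)
    (h : ∀ k, φ (Function.update g i k, q) = if k = l then c else 0) :
    localOp i A φ (g, q) = c * matElem A (g i) l := by
  rw [localOp_apply]
  have : slice (splitEquiv ι P i) (fun j => g j, q) φ = c • lp.single 2 l (1 : ℂ) := by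
    ext k
    rw [slice_apply, splitEquiv_apply, h]
    by_cases hk : k = l
    · subst hk; simp
    · simp [hk]
  rw [this, map_smul]
  rfl

theorem hasSum_matElem {ι κ : Type u} (A : Ell2 ι →L[ℂ] Ell2 κ) (φ : Ell2 ι) (g : κ) :
    HasSum (fun f => matElem A g f * φ f) (A φ g) := by
  classical
  have h := (((lp.evalCLM ℂ (fun _ : κ => ℂ) 2 g).comp A).hasSum
    (lp.hasSum_single (p := 2) (by simp) φ))
  convert! h using 2 with f
  have : lp.single 2 f (φ f) = (φ f) • lp.single (E := fun _ : ι => ℂ) 2 f (1 : ℂ) := by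
    rw [← lp.single_smul]; simp
  simp only [this, map_smul, smul_eq_mul, matElem]
  rw [mul_comm]
  simp only [ContinuousLinearMap.comp_apply]
  change _ * (A _) g = _ * (A _) g
  congr! 4

theorem ext_matElem {ι κ : Type u} {A B : Ell2 ι →L[ℂ] Ell2 κ}
    (h : ∀ g f, matElem A g f = matElem B g f) : A = B := by
  ext φ g
  refine (hasSum_matElem A φ g).unique ?_
  simp only [h]
  exact hasSum_matElem B φ g

open Classical in
theorem matElem_one {ι : Type u} (g f : ι) :
    matElem (1 : Ell2 ι →L[ℂ] Ell2 ι) g f = if g = f then 1 else 0 := by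
  by_cases h : g = f
  · subst h; simp [matElem]
  · simp [matElem, h]

open Classical in
theorem matElem_localOp (i : Fin N) (A : Ell2 (ι i) →L[ℂ] Ell2 (ι i)) (g f : ∀ i, ι i)
    (q q' : P) :
    matElem (localOp i A) (g, q) (f, q') =
      (if q = q' ∧ ∀ j, j ≠ i → g j = f j then 1 else 0) * matElem A (g i) (f i) := by
  rw [matElem, localOp_apply_of_slice (l := f i)]
  intro k
  rw [coe_single_one (dec := Classical.propDecidable _)]
  have : ((Function.update g i k, q) = (f, q')) ↔
      k = f i ∧ (q = q' ∧ ∀ j, j ≠ i → g j = f j) := by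
    rw [Prod.ext_iff, Function.update_eq_iff]; tauto
  simp only [this, ite_and]

theorem localOp_commute {i j : Fin N} (hij : i ≠ j) (A : Ell2 (ι i) →L[ℂ] Ell2 (ι i))
    (B : Ell2 (ι j) →L[ℂ] Ell2 (ι j)) :
    Commute (localOp (P := P) i A) (localOp j B) := by
  classical
  -- The kernel of the product is symmetric under exchanging the two parties, so both orders have
  -- the same matrix elements.
  have key : ∀ {i j : Fin N} (_ : i ≠ j) (A : Ell2 (ι i) →L[ℂ] Ell2 (ι i))
      (B : Ell2 (ι j) →L[ℂ] Ell2 (ι j)) (g f : ∀ i, ι i) (q q' : P),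
      matElem (localOp (P := P) i A * localOp j B) (g, q) (f, q') =
        (if q = q' ∧ ∀ l, l ≠ i → l ≠ j → g l = f l then 1 else 0) *
          (matElem A (g i) (f i) * matElem B (g j) (f j)) := by
    intro i j hij A B g f q q'
    rw [matElem, mul_apply_eq_comp, localOp_apply_of_slice (l := f i)
      (c := (if q = q' ∧ ∀ l, l ≠ i → l ≠ j → g l = f l then 1 else 0) *
        matElem B (g j) (f j))]
    · ring
    intro k
    have := matElem_localOp j B (Function.update g i k) f q q'
    rw [matElem] at this
    rw [this, Function.update_of_ne hij.symm]
    have : (∀ l, l ≠ j → Function.update g i k l = f l) ↔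
        k = f i ∧ ∀ l, l ≠ i → l ≠ j → g l = f l := by
      constructor
      · intro h
        refine ⟨by simpa using h i hij, fun l hl hl' => by simpa [hl] using h l hl'⟩
      · rintro ⟨h, h'⟩ l hl
        by_cases hli : l = i
        · subst hli; simpa using h
        · simpa [hli] using h' l hli hl
    simp only [this]
    by_cases hk : k = f i <;> simp [hk]
  refine ext_matElem fun ⟨g, q⟩ ⟨f, q'⟩ => ?_
  rw [key hij, key hij.symm]
  have : (∀ l, l ≠ i → l ≠ j → g l = f l) ↔ ∀ l, l ≠ j → l ≠ i → g l = f l :=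
    ⟨fun h l a b => h l b a, fun h l a b => h l b a⟩
  simp only [this]
  ring

/-- The tensor product `A₁ ⊗ ⋯ ⊗ A_N ⊗ 1_P` as a bounded operator. -/
def tensorOp :
    (∀ i, Ell2 (ι i) →L[ℂ] Ell2 (ι i)) →*
      (Ell2 ((∀ i, ι i) × P) →L[ℂ] Ell2 ((∀ i, ι i) × P)) :=
  MonoidHom.noncommPiCoprod (fun i => MonoidHomClass.toMonoidHom (localOp i))
    fun _ _ hij A B => localOp_commute hij A B

theorem tensorOp_apply (A : ∀ i, Ell2 (ι i) →L[ℂ] Ell2 (ι i)) :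
    tensorOp (P := P) A = Finset.univ.noncommProd (fun i => localOp i (A i))
      (fun _ _ _ _ hij => localOp_commute hij _ _) := rfl

@[simp]
theorem tensorOp_mulSingle (i : Fin N) (A : Ell2 (ι i) →L[ℂ] Ell2 (ι i)) :
    tensorOp (P := P) (Pi.mulSingle i A) = localOp i A :=
  MonoidHom.noncommPiCoprod_mulSingle _ _ _

-- Proved by induction on the set of parties whose operator is not replaced by `1`; each step peels
-- off one `localOp`.
open Classical in
theorem matElem_tensorOp (A : ∀ i, Ell2 (ι i) →L[ℂ] Ell2 (ι i)) (g f : ∀ i, ι i) (q q' : P) :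
    matElem (tensorOp A) (g, q) (f, q') =
      (if q = q' then 1 else 0) * ∏ i, matElem (A i) (g i) (f i) := by
  have key : ∀ (s : Finset (Fin N)) (g f : ∀ i, ι i) (q q' : P),
      matElem (tensorOp (s.piecewise A 1)) (g, q) (f, q') =
        (if q = q' then 1 else 0) * ∏ i, matElem (s.piecewise A 1 i) (g i) (f i) := by
    intro s
    induction s using Finset.induction_on with
    | empty =>
      intro g f q q'
      simp only [Finset.piecewise_empty, map_one, Pi.one_apply, matElem_one]
      rw [Finset.prod_ite_zero]
      simp only [Prod.mk.injEq, funext_iff, Finset.mem_univ, true_imp_iff, Finset.prod_const_one]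
      by_cases h : q = q' <;> simp [h]
    | insert i s his ih =>
      intro g f q q'
      have hA : (insert i s).piecewise A 1 = Pi.mulSingle i (A i) * s.piecewise A 1 := by
        ext1 j
        by_cases hj : j = i
        · subst hj; simp [his]
        · simp [hj, Finset.piecewise]
      have hA' : ∀ j, j ≠ i → (insert i s).piecewise A 1 j = s.piecewise A 1 j := fun j hj => by
        simp [hj, Finset.piecewise]
      rw [hA, map_mul, tensorOp_mulSingle, ← hA, matElem, mul_apply_eq_comp,
        localOp_apply_of_slice (l := f i) (c := (if q = q' then 1 else 0) *
          ∏ j ∈ Finset.univ.erase i, matElem (s.piecewise A 1 j) (g j) (f j))]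
      · rw [← Finset.mul_prod_erase _ _ (Finset.mem_univ i), Finset.piecewise_insert_self, mul_assoc,
          mul_comm (∏ j ∈ _, _)]
        congr 2
        exact Finset.prod_congr rfl fun j hj => by rw [hA' j (Finset.ne_of_mem_erase hj)]
      · intro k
        have := ih (Function.update g i k) f q q'
        rw [matElem] at this
        rw [this, ← Finset.mul_prod_erase _ _ (Finset.mem_univ i),
          Finset.piecewise_eq_of_notMem _ _ _ his, Pi.one_apply, Function.update_self, matElem_one]
        by_cases hk : k = f i
        · rw [if_pos hk, if_pos hk, one_mul]
          congr 1
          exact Finset.prod_congr rfl fun j hj => by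
            rw [Function.update_of_ne (Finset.ne_of_mem_erase hj)]
        · rw [if_neg hk, if_neg hk, zero_mul, mul_zero]
  have := key Finset.univ g f q q'
  simpa only [Finset.piecewise_univ] using this

/-- Convergence comes for free from the row expansion of a bounded operator. Entries with a
different purification label vanish, which leaves the series that defines `tensorApply`. -/
theorem hasSum_tensorOp (A : ∀ i, Ell2 (ι i) →L[ℂ] Ell2 (ι i)) (ψ : Ell2 ((∀ i, ι i) × P))
    (g : ∀ i, ι i) (q : P) :
    HasSum (fun f => (∏ i, matElem (A i) (g i) (f i)) * ψ (f, q)) (tensorOp A ψ (g, q)) := by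
  classical
  have h := hasSum_matElem (tensorOp A) ψ (g, q)
  have hinj : Function.Injective fun f : ∀ i, ι i => (f, q) := fun f f' h => by simpa using h
  rw [← hinj.hasSum_iff] at h
  · convert! h using 2 with f
    simp [matElem_tensorOp]
  · rintro ⟨f, q'⟩ hf
    have : q ≠ q' := by
      rintro rfl
      exact hf ⟨f, rfl⟩
    simp [matElem_tensorOp, this]

theorem tensorApply_eq (A : ∀ i, Ell2 (ι i) →L[ℂ] Ell2 (ι i)) (ψ : Ell2 ((∀ i, ι i) × P)) :
    tensorApply A ψ = tensorOp A ψ := by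
  ext ⟨g, q⟩
  exact (hasSum_tensorOp A ψ g q).tsum_eq

theorem matElem_sum_smul {ι κ : Type u} {α : Type*} [Fintype α] (c : α → ℂ)
    (E : α → Ell2 ι →L[ℂ] Ell2 κ) (g : κ) (f : ι) :
    matElem (∑ a, c a • E a) g f = ∑ a, c a * matElem (E a) g f := by
  simp only [matElem, sum_apply, smul_apply,
    lp.coeFn_sum, Finset.sum_apply, lp.coeFn_smul, Pi.smul_apply, smul_eq_mul]

theorem tensorOp_sum {α : Type*} [Fintype α] (c : Fin N → α → ℂ)
    (E : ∀ i, α → Ell2 (ι i) →L[ℂ] Ell2 (ι i)) :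
    tensorOp (P := P) (fun i => ∑ a, c i a • E i a) =
      ∑ a : Fin N → α, (∏ i, c i (a i)) • tensorOp fun i => E i (a i) := by
  classical
  refine ext_matElem fun ⟨g, q⟩ ⟨f, q'⟩ => ?_
  rw [matElem_sum_smul]
  simp only [matElem_tensorOp, matElem_sum_smul]
  rw [Finset.prod_univ_sum, Finset.mul_sum, Fintype.piFinset_univ]
  refine Finset.sum_congr rfl fun a _ => ?_
  rw [Finset.prod_mul_distrib]
  ring

theorem localOp_eq_self_of_slice (i : Fin N) {A : Ell2 (ι i) →L[ℂ] Ell2 (ι i)}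
    {ψ : Ell2 ((∀ i, ι i) × P)} (h : ∀ b, A (slice (splitEquiv ι P i) b ψ) =
      slice (splitEquiv ι P i) b ψ) : localOp i A ψ = ψ :=
  ext_slice (splitEquiv ι P i) fun b => (slice_amplify _ _ _ _).trans (h b)

theorem slice_localOp (i : Fin N) (A : Ell2 (ι i) →L[ℂ] Ell2 (ι i))
    (ψ : Ell2 ((∀ i, ι i) × P)) (b) :
    slice (splitEquiv ι P i) b (localOp i A ψ) = A (slice (splitEquiv ι P i) b ψ) :=
  slice_amplify _ _ _ _

theorem tensorOp_eq_self {A : ∀ i, Ell2 (ι i) →L[ℂ] Ell2 (ι i)} {ψ : Ell2 ((∀ i, ι i) × P)}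
    (h : ∀ i, localOp i (A i) ψ = ψ) : tensorOp A ψ = ψ := by
  -- The operators fixing `ψ` form a submonoid, hence contain the product.
  have := Submonoid.noncommProd_mem
    (MulAction.stabilizerSubmonoid (Ell2 ((∀ i, ι i) × P) →L[ℂ] Ell2 ((∀ i, ι i) × P)) ψ)
    Finset.univ (fun i => localOp i (A i)) (fun _ _ _ _ hij => localOp_commute hij _ _)
    fun i _ => h i
  rw [MulAction.mem_stabilizerSubmonoid_iff] at this
  rw [tensorOp_apply]
  exact this

theorem norm_tensorOp_le {A : ∀ i, Ell2 (ι i) →L[ℂ] Ell2 (ι i)} (h : ∀ i, ‖A i‖ ≤ 1) :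
    ‖tensorOp (P := P) A‖ ≤ 1 := by
  rw [tensorOp_apply]
  refine Finset.noncommProd_induction _ _ _ (fun B => ‖B‖ ≤ 1) (fun B C hB hC => ?_) ?_ ?_
  · exact (norm_mul_le _ _).trans (mul_le_one₀ hB (norm_nonneg _) hC)
  · exact ContinuousLinearMap.norm_id_le
  · intro i _
    exact (NonUnitalStarAlgHom.norm_apply_le (localOp i) (A i)).trans (h i)

end TensorOp

/-! ### A qubit inside one party: anticommuting involutions on a subspace. -/

section Party

section Algebra

variable {B : Type*} [Ring B] [StarRing B] [Algebra ℂ B]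

/-- The components of the local isometry that extracts a qubit from two anticommuting self-adjoint
partial involutions `x`, `y` with common support projection `q`. -/
def pauliComponent (x y q : B) : Fin 2 → B :=
  ![(1 / 2 : ℂ) • (q - Complex.I • (x * y)) + (1 - q), (1 / 2 : ℂ) • (x + Complex.I • y)]

/-- `x` and `y` are anticommuting self-adjoint partial involutions with support projection `q`. -/
structure IsPauliPair (x y q : B) : Prop where
  star_fst : star x = x
  star_snd : star y = y
  star_supp : star q = q
  fst_sq : x * x = q
  snd_sq : y * y = q
  anticomm : y * x = -(x * y)
  supp_fst : q * x = x
  supp_snd : q * y = y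
  fst_supp : x * q = x
  snd_supp : y * q = y
  supp_sq : q * q = q

variable {x y q : B}

theorem IsPauliPair.component_mul_fst (h : IsPauliPair x y q) (g : Fin 2) :
    pauliComponent x y q g * x = ∑ k, σx g k • (pauliComponent x y q k * q) := by
  have hxx' : ∀ b, x * (x * b) = q * b := fun b => by rw [← mul_assoc, h.fst_sq]
  fin_cases g <;>
  · simp [σx, pauliComponent, add_mul, sub_mul, mul_assoc, h.fst_sq, h.anticomm, h.supp_fst,
      h.supp_snd, h.fst_supp, h.snd_supp, h.supp_sq, hxx']
    try module

theorem IsPauliPair.component_mul_snd (h : IsPauliPair x y q) (g : Fin 2) :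
    pauliComponent x y q g * y = ∑ k, σy g k • (pauliComponent x y q k * q) := by
  fin_cases g <;>
  · simp [σy, pauliComponent, add_mul, sub_mul, mul_assoc, h.snd_sq, h.supp_snd,
      h.fst_supp, h.snd_supp, h.supp_sq, smul_smul, smul_sub, smul_add, mul_comm Complex.I]
    try module

theorem IsPauliPair.component_mul_fst_mul_snd (h : IsPauliPair x y q) (g : Fin 2) :
    pauliComponent x y q g * (x * y) =
      ((-1 : ℂ) ^ (g : ℕ) * Complex.I) • (pauliComponent x y q g * q) := by
  rw [← mul_assoc, h.component_mul_fst, Finset.sum_mul]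
  simp only [smul_mul_assoc, mul_assoc, h.supp_snd]
  simp only [h.component_mul_snd, Finset.smul_sum, smul_smul]
  fin_cases g <;> simp [σx, σy]

/-- With `x y = i z`, component 0 is the projection `(q + z) / 2` plus `1 - q`, and component 1 is
`x (q - z) / 2`. Their squares add up to `q + (1 - q)`: the complement of `q` is put in component 0
only to obtain an isometry on the whole space. -/
theorem IsPauliPair.sum_star_component_mul_self [StarModule ℂ B] (h : IsPauliPair x y q) :
    ∑ g, star (pauliComponent x y q g) * pauliComponent x y q g = 1 := by
  have hyx' : ∀ b, y * (x * b) = -(x * (y * b)) := fun b => by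
    rw [← mul_assoc, h.anticomm, neg_mul, mul_assoc]
  have hqx' : ∀ b, q * (x * b) = x * b := fun b => by rw [← mul_assoc, h.supp_fst]
  simp [pauliComponent, mul_add, add_mul, mul_sub, sub_mul, mul_assoc, h.star_fst, h.star_snd,
    h.star_supp, h.fst_sq, h.snd_sq, h.anticomm, h.fst_supp, h.snd_supp, h.supp_sq, hyx', hqx',
    smul_smul, smul_sub, smul_add]
  match_scalars <;> ring_nf <;> simp

end Algebra

variable {E : Type*} [NormedAddCommGroup E] [InnerProductSpace ℂ E]

/-- The vectors on which `X` and `Y` act as anticommuting involutions. -/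
def anticommutingSubmodule (X Y : E →L[ℂ] E) : Submodule ℂ E where
  carrier := {v | X (X v) = v ∧ Y (Y v) = v ∧ Y (X v) = -X (Y v) ∧
    X (X (Y v)) = Y v ∧ Y (Y (X v)) = X v}
  zero_mem' := by simp
  add_mem' := by
    rintro v w ⟨h1, h2, h3, h4, h5⟩ ⟨k1, k2, k3, k4, k5⟩
    refine ⟨by simp only [map_add, h1, k1], by simp only [map_add, h2, k2], ?_,
      by simp only [map_add, h4, k4], by simp only [map_add, h5, k5]⟩
    simp only [map_add, h3, k3, neg_add]
  smul_mem' := by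
    rintro c v ⟨h1, h2, h3, h4, h5⟩
    refine ⟨by simp only [map_smul, h1], by simp only [map_smul, h2], ?_,
      by simp only [map_smul, h4], by simp only [map_smul, h5]⟩
    simp only [map_smul, h3, smul_neg]

theorem isClosed_anticommutingSubmodule (X Y : E →L[ℂ] E) :
    IsClosed (anticommutingSubmodule X Y : Set E) := by
  refine IsClosed.inter (isClosed_eq ?_ ?_) (IsClosed.inter (isClosed_eq ?_ ?_)
    (IsClosed.inter (isClosed_eq ?_ ?_) (IsClosed.inter (isClosed_eq ?_ ?_)
      (isClosed_eq ?_ ?_)))) <;> fun_prop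

/-- The last two defining relations of the submodule are there for this invariance: they say that
`X` remains an involution on `Y v`, and `Y` on `X v`. -/
theorem map_fst_mem_anticommutingSubmodule {X Y : E →L[ℂ] E} {v : E}
    (hv : v ∈ anticommutingSubmodule X Y) : X v ∈ anticommutingSubmodule X Y := by
  obtain ⟨h1, h2, h3, h4, h5⟩ := hv
  exact ⟨by rw [h1], h5, by rw [h1, h3, map_neg, h4, neg_neg],
    by rw [h3, map_neg, map_neg, h4], by rw [h1, h2]⟩

theorem map_snd_mem_anticommutingSubmodule {X Y : E →L[ℂ] E} {v : E}
    (hv : v ∈ anticommutingSubmodule X Y) : Y v ∈ anticommutingSubmodule X Y := by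
  obtain ⟨h1, h2, h3, h4, h5⟩ := hv
  have h : X (Y v) = -Y (X v) := by rw [h3, neg_neg]
  exact ⟨h4, by rw [h2], by rw [h, map_neg, h5, h2], by rw [h2, h1],
    by rw [h, map_neg, map_neg, h5]⟩

variable [CompleteSpace E]

/-- The projection onto a closed subspace invariant under `A = A†` commutes with `A`. -/
theorem starProjection_commute_of_invariant {V : Submodule ℂ E} [V.HasOrthogonalProjection]
    {A : E →L[ℂ] E} (hA : IsSelfAdjoint A) (h : ∀ v ∈ V, A v ∈ V) :
    V.starProjection * A = A * V.starProjection := by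
  have h1 : V.starProjection * A * V.starProjection = A * V.starProjection := by
    ext v
    simp only [mul_apply_eq_comp]
    exact Submodule.starProjection_eq_self_iff.2 (h _ (Submodule.starProjection_apply_mem V v))
  have hP : star V.starProjection = V.starProjection := (isSelfAdjoint_starProjection V).star_eq
  have h2 := congrArg star h1
  simp only [star_mul, hP, hA.star_eq, ← mul_assoc] at h2
  rw [← h2, h1]

/-- Two self-adjoint operators are, where they act as anticommuting involutions, a pair of Pauli
operators up to a local isometry, the components of which are `L 0` and `L 1`. -/
theorem exists_pauli_components {X Y : E →L[ℂ] E} (hX : IsSelfAdjoint X) (hY : IsSelfAdjoint Y) :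
    ∃ (Q : E →L[ℂ] E) (L : Fin 2 → E →L[ℂ] E),
      (∀ v, X (X v) = v → Y (Y v) = v → Y (X v) = -X (Y v) → X (X (Y v)) = Y v →
        Y (Y (X v)) = X v → Q v = v) ∧
      ∑ g, star (L g) * L g = 1 ∧
      (∀ g, L g * X * Q = ∑ h, σx g h • (L h * Q)) ∧
      (∀ g, L g * Y * Q = ∑ h, σy g h • (L h * Q)) ∧
      ∀ g : Fin 2, L g * (X * Y) * Q = ((-1 : ℂ) ^ (g : ℕ) * Complex.I) • (L g * Q) := by
  set V := anticommutingSubmodule X Y with hV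
  have : CompleteSpace V := (isClosed_anticommutingSubmodule X Y).completeSpace_coe
  set Q := V.starProjection with hQdef
  have hQV : ∀ v, Q v ∈ V := fun v => Submodule.starProjection_apply_mem V v
  have hQ : star Q = Q := (isSelfAdjoint_starProjection V).star_eq
  have hQQ : Q * Q = Q := Submodule.isIdempotentElem_starProjection V
  have hQX : Q * X = X * Q := starProjection_commute_of_invariant hX
    fun v hv => map_fst_mem_anticommutingSubmodule hv
  have hQY : Q * Y = Y * Q := starProjection_commute_of_invariant hY
    fun v hv => map_snd_mem_anticommutingSubmodule hv
  have hXX : X * (X * Q) = Q := by ext v; exact (hQV v).1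
  have hYY : Y * (Y * Q) = Q := by ext v; exact (hQV v).2.1
  have hYX : Y * (X * Q) = -(X * (Y * Q)) := by ext v; exact (hQV v).2.2.1
  have hqx : Q * (X * Q) = X * Q := by rw [← mul_assoc, hQX, mul_assoc, hQQ]
  have hqy : Q * (Y * Q) = Y * Q := by rw [← mul_assoc, hQY, mul_assoc, hQQ]
  -- `X` and `Y` need not be involutions on the whole space, so they are cut down by the projection
  -- `Q`, with which both commute.
  have h : IsPauliPair (X * Q) (Y * Q) Q :=
    { star_fst := by rw [star_mul, hQ, hX.star_eq, hQX]
      star_snd := by rw [star_mul, hQ, hY.star_eq, hQY]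
      star_supp := hQ
      fst_sq := by rw [mul_assoc, hqx, hXX]
      snd_sq := by rw [mul_assoc, hqy, hYY]
      anticomm := by rw [mul_assoc, hqx, mul_assoc, hqy, hYX]
      supp_fst := hqx
      supp_snd := hqy
      fst_supp := by rw [mul_assoc, hQQ]
      snd_supp := by rw [mul_assoc, hQQ]
      supp_sq := hQQ }
  refine ⟨Q, pauliComponent (X * Q) (Y * Q) Q, fun v h1 h2 h3 h4 h5 => ?_,
    h.sum_star_component_mul_self, fun g => ?_, fun g => ?_, fun g => ?_⟩
  · exact Submodule.starProjection_eq_self_iff.2 ⟨h1, h2, h3, h4, h5⟩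
  · rw [mul_assoc, h.component_mul_fst]
  · rw [mul_assoc, h.component_mul_snd]
  · rw [← h.component_mul_fst_mul_snd]
    simp only [mul_assoc, hqy]

end Party

/-! ### Vectors of qubits and the norm of the GHZ state. -/

section Qubits

variable {N : ℕ}

theorem qubitApply_qubitApply (B C : Fin N → Matrix (Fin 2) (Fin 2) ℂ) (Φ : Qubits N) :
    qubitApply B (qubitApply C Φ) = qubitApply (fun i => B i * C i) Φ := by
  ext g
  simp only [qubitApply, Matrix.mul_apply, Finset.prod_univ_sum, Fintype.piFinset_univ,
    Finset.mul_sum, Finset.sum_mul, Finset.prod_mul_distrib]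
  rw [Finset.sum_comm]
  simp only [mul_assoc]

theorem qubitApply_one (Φ : Qubits N) : qubitApply (fun _ => 1) Φ = Φ := by
  ext g
  have h : ∀ f : Bits N, ∏ i, (1 : Matrix (Fin 2) (Fin 2) ℂ) (g i) (f i) =
      if g = f then 1 else 0 := fun f => by
    simp [Matrix.one_apply, Finset.prod_ite_zero, funext_iff]
  simp [qubitApply, h]

theorem sum_norm_ghz_sq (hN : N ≠ 0) : ∑ g : Bits N, ‖ghz N g‖ ^ 2 = 1 := by
  have : NeZero N := ⟨hN⟩
  have h : ∀ g : Bits N, ‖ghz N g‖ ^ 2 =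
      (if g = (fun _ => 0) then 1 / 2 else 0) + (if g = (fun _ => 1) then 1 / 2 else 0) := by
    intro g
    simp only [ghz, ← funext_iff]
    by_cases h0 : g = fun _ => 0
    · have h1 : ¬ g = fun _ => 1 := by
        rintro rfl
        simpa using congrFun h0 0
      simp [h0, funext_iff]
    · by_cases h1 : g = fun _ => 1
      · simp [h1, funext_iff]
      · simp [h0, h1]
  simp only [h, Finset.sum_add_distrib, Finset.sum_ite_eq', Finset.mem_univ, if_true]
  norm_num

end Qubits

/-! ### Extraction of a GHZ state from its stabilizer relations. -/

section Extraction

variable {N : ℕ} {ι : Fin N → Type u} {P : Type u}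

theorem tensorOp_smul (c : Fin N → ℂ) (A : ∀ i, Ell2 (ι i) →L[ℂ] Ell2 (ι i)) :
    tensorOp (P := P) (fun i => c i • A i) = (∏ i, c i) • tensorOp A := by
  simpa using tensorOp_sum (P := P) (fun i (_ : Unit) => c i) (fun i _ => A i)

theorem matElem_star {κ : Type u} (A : Ell2 κ →L[ℂ] Ell2 κ) (g f : κ) :
    matElem (star A) g f = conj (matElem A f g) := by
  classical
  have h : ∀ (A : Ell2 κ →L[ℂ] Ell2 κ) (g f : κ), matElem A g f =
      ⟪lp.single (E := fun _ : κ => ℂ) 2 g 1, A (lp.single 2 f 1)⟫_ℂ := fun A g f => by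
    rw [lp.inner_single_left, matElem]
    simp
  rw [h, h, inner_conj_symm, ContinuousLinearMap.star_eq_adjoint,
    ContinuousLinearMap.adjoint_inner_right]

theorem star_tensorOp (A : ∀ i, Ell2 (ι i) →L[ℂ] Ell2 (ι i)) :
    star (tensorOp (P := P) A) = tensorOp fun i => star (A i) := by
  classical
  refine ext_matElem fun ⟨g, q⟩ ⟨f, q'⟩ => ?_
  rw [matElem_star, matElem_tensorOp, matElem_tensorOp]
  simp only [matElem_star, map_mul, map_prod, eq_comm (a := q)]
  congr 1
  split_ifs <;> simp

/-- A tensor product of isometries is an isometry: expanding `⊗ (∑ g, L† L) = 1` by multilinearity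
gives the sum over all strings. -/
theorem sum_norm_tensorOp_sq {L : ∀ i, Fin 2 → Ell2 (ι i) →L[ℂ] Ell2 (ι i)}
    (hL : ∀ i, ∑ g, star (L i g) * L i g = 1) (ψ : Ell2 ((∀ i, ι i) × P)) :
    ∑ g : Bits N, ‖tensorOp (fun i => L i (g i)) ψ‖ ^ 2 = ‖ψ‖ ^ 2 := by
  have h1 := tensorOp_sum (P := P) (fun (i : Fin N) (_ : Fin 2) => 1)
    fun i g => star (L i g) * L i g
  simp only [one_smul, Finset.prod_const_one, hL] at h1
  have h2 : ∀ g : Bits N, ‖tensorOp (fun i => L i (g i)) ψ‖ ^ 2 =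
      (⟪ψ, tensorOp (fun i => star (L i (g i)) * L i (g i)) ψ⟫_ℂ).re := fun g => by
    rw [← inner_self_eq_norm_sq (𝕜 := ℂ), ← ContinuousLinearMap.adjoint_inner_right,
      ← ContinuousLinearMap.star_eq_adjoint, star_tensorOp, ← mul_apply_eq_comp, ← map_mul]
    rfl
  simp only [h2]
  rw [← Complex.re_sum, ← inner_sum, ← sum_apply, ← h1]
  change (⟪ψ, tensorOp 1 ψ⟫_ℂ).re = _
  rw [map_one, ← inner_self_eq_norm_sq (𝕜 := ℂ)]
  rfl

/-- The intertwining relations hold only on the range of `Q`; since `Q` fixes `ψ`, it can be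
inserted before and removed after using them. -/
theorem tensorOp_tensorOp_of_components {L : ∀ i, Fin 2 → Ell2 (ι i) →L[ℂ] Ell2 (ι i)}
    {Q B : ∀ i, Ell2 (ι i) →L[ℂ] Ell2 (ι i)} {b : Fin N → Matrix (Fin 2) (Fin 2) ℂ}
    (h : ∀ i g, L i g * B i * Q i = ∑ k, b i g k • (L i k * Q i))
    {ψ : Ell2 ((∀ i, ι i) × P)} (hQ : tensorOp Q ψ = ψ) (g : Bits N) :
    tensorOp (fun i => L i (g i)) (tensorOp B ψ) =
      ∑ k : Bits N, (∏ i, b i (g i) (k i)) • tensorOp (fun i => L i (k i)) ψ := by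
  have h1 : (fun i => L i (g i)) * B * Q = fun i => ∑ k, b i (g i) k • (L i k * Q i) :=
    funext fun i => h i (g i)
  have h2 : ∀ k : Bits N, tensorOp (P := P) (fun i => L i (k i) * Q i) ψ =
      tensorOp (fun i => L i (k i)) ψ := fun k => by
    rw [show (fun i => L i (k i) * Q i) = (fun i => L i (k i)) * Q from rfl, map_mul,
      mul_apply_eq_comp, hQ]
  nth_rw 1 [← hQ]
  rw [← mul_apply_eq_comp, ← mul_apply_eq_comp, ← map_mul, ← map_mul, h1, tensorOp_sum]
  simp only [sum_apply, smul_apply, h2]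

/-- A state on which the parties act by anticommuting involutions obeying the stabilizer relations
of the GHZ state is, up to local isometries, a GHZ state. -/
theorem exists_ghz_components (hN : N ≠ 0) {X Y : ∀ i, Ell2 (ι i) →L[ℂ] Ell2 (ι i)}
    (hX : ∀ i, IsSelfAdjoint (X i)) (hY : ∀ i, IsSelfAdjoint (Y i))
    {ψ φ : Ell2 ((∀ i, ι i) × P)} (hψ : ‖ψ‖ = 1)
    (hXX : ∀ i, localOp i (X i) (localOp i (X i) ψ) = ψ)
    (hYY : ∀ i, localOp i (Y i) (localOp i (Y i) ψ) = ψ)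
    (hYX : ∀ i, localOp i (Y i) (localOp i (X i) ψ) = -localOp i (X i) (localOp i (Y i) ψ))
    (hXXY : ∀ i, localOp i (X i) (localOp i (X i) (localOp i (Y i) ψ)) = localOp i (Y i) ψ)
    (hYYX : ∀ i, localOp i (Y i) (localOp i (Y i) (localOp i (X i) ψ)) = localOp i (X i) ψ)
    (hZ : ∀ i, localOp i (X i) (localOp i (Y i) ψ) = φ) (hT : tensorOp X ψ = ψ) :
    ∃ (L : ∀ i, Fin 2 → Ell2 (ι i) →L[ℂ] Ell2 (ι i)) (ζ : Ell2 ((∀ i, ι i) × P)),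
      (∀ i, ∑ g, star (L i g) * L i g = 1) ∧ ‖ζ‖ = 1 ∧
      (∀ g : Bits N, tensorOp (fun i => L i (g i)) ψ = ghz N g • ζ) ∧
      ∀ (c d : Fin N → ℂ) (g : Bits N),
        tensorOp (fun i => L i (g i)) (tensorOp (fun i => c i • X i + d i • Y i) ψ) =
          qubitApply (fun i => c i • σx + d i • σy) (ghz N) g • ζ := by
  choose Q L hQ hL hLX hLY hLZ using fun i => exists_pauli_components (hX i) (hY i)
  have hQψ : tensorOp Q ψ = ψ := by
    -- Relations on `ψ` hold on each slice of `ψ`, so every slice lies where `Q i` is the identity.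
    refine tensorOp_eq_self fun i => localOp_eq_self_of_slice i fun b => hQ i _ ?_ ?_ ?_ ?_ ?_
    · simp only [← slice_localOp, hXX]
    · simp only [← slice_localOp, hYY]
    · simp only [← slice_localOp, hYX, map_neg]
    · simp only [← slice_localOp, hXXY]
    · simp only [← slice_localOp, hYYX]
  set W : Bits N → Ell2 ((∀ i, ι i) × P) := fun g => tensorOp (fun i => L i (g i)) ψ with hW
  -- `φ` is `i Z ψ` for every party at once, so each bit of `g` determines the phase of the same
  -- vector.
  have hWZ : ∀ (g : Bits N) i, tensorOp (fun i => L i (g i)) φ =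
      ((-1 : ℂ) ^ (g i : ℕ) * Complex.I) • W g := by
    intro g i
    have h1 : (fun j => L j (g j)) * Pi.mulSingle i (X i * Y i) * Q =
        fun j => (if j = i then (-1 : ℂ) ^ (g i : ℕ) * Complex.I else 1) • (L j (g j) * Q j) := by
      ext1 j
      by_cases hj : j = i
      · subst hj
        simp only [Pi.mul_apply, Pi.mulSingle_eq_same, if_true, hLZ]
      · simp [hj]
    have h2 : φ = tensorOp (Pi.mulSingle i (X i * Y i)) ψ := by
      rw [tensorOp_mulSingle, map_mul, mul_apply_eq_comp, hZ]
    rw [h2]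
    nth_rw 1 [← hQψ]
    rw [← mul_apply_eq_comp, ← mul_apply_eq_comp, ← map_mul, ← map_mul, h1, tensorOp_smul, Finset.prod_ite_eq' Finset.univ i,
      if_pos (Finset.mem_univ i), smul_apply]
    change _ • tensorOp ((fun i => L i (g i)) * Q) ψ = _
    rw [map_mul, mul_apply_eq_comp, hQψ]
  have hWX : W (fun _ => 1) = W (fun _ => 0) := by
    have h := tensorOp_tensorOp_of_components hLX hQψ (fun _ => 1)
    rw [hT] at h
    simp only [hW]
    rw [h, Finset.sum_eq_single (fun _ => 0)]
    · simp [σx]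
    · intro k _ hk
      obtain ⟨i, hi⟩ := Function.ne_iff.1 hk
      rw [Finset.prod_eq_zero (Finset.mem_univ i), zero_smul]
      have : k i = 1 := by omega
      simp [σx, this]
    · simp
  -- Two different bits give the same vector the phases `i` and `-i`, which forces it to vanish.
  have hW0 : ∀ g : Bits N, ∀ i j, g i = 0 → g j = 1 → W g = 0 := by
    intro g i j hi hj
    have h := (hWZ g i).symm.trans (hWZ g j)
    rw [hi, hj] at h
    have h2 : ((2 : ℂ) * Complex.I) • W g = 0 := by
      rw [← sub_eq_zero, ← sub_smul] at h
      convert! h using 2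
      simp; ring
    simpa using h2
  obtain ⟨ζ, hWghz⟩ : ∃ ζ, ∀ g : Bits N, W g = ghz N g • ζ := by
    -- The factor `√2` compensates the amplitude `1 / √2` of the GHZ state at `0⋯0`.
    refine ⟨((√2 : ℝ) : ℂ) • W (fun _ => 0), ?_⟩
    have : NeZero N := ⟨hN⟩
    have h2 : ((√2 : ℝ) : ℂ) ≠ 0 := by simp
    intro g
    by_cases h0 : g = fun _ => 0
    · subst h0
      have h3 : ghz N (fun _ => 0) * ((√2 : ℝ) : ℂ) = 1 := by simp [ghz]
      rw [smul_smul, h3, one_smul]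
    by_cases h1 : g = fun _ => 1
    · subst h1
      have h3 : ghz N (fun _ => 1) * ((√2 : ℝ) : ℂ) = 1 := by simp [ghz]
      rw [smul_smul, h3, one_smul, hWX]
    obtain ⟨j, hj⟩ := Function.ne_iff.1 h0
    obtain ⟨i, hi⟩ := Function.ne_iff.1 h1
    rw [hW0 g i j (by omega) (by omega)]
    simp [ghz, ← funext_iff, h0, h1]
  refine ⟨L, ζ, hL, ?_, hWghz, fun c d g => ?_⟩
  · have h := sum_norm_tensorOp_sq hL ψ
    change ∑ g, ‖W g‖ ^ 2 = _ at h
    simp only [hWghz, norm_smul, mul_pow] at h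
    rw [← Finset.sum_mul, sum_norm_ghz_sq hN, hψ, one_mul, one_pow] at h
    exact (pow_eq_one_iff_of_nonneg (norm_nonneg _) two_ne_zero).1 h
  · rw [tensorOp_tensorOp_of_components (b := fun i => c i • σx + d i • σy) _ hQψ]
    · change ∑ k, _ • W k = _
      simp only [hWghz, smul_smul, ← Finset.sum_smul, qubitApply]
    · intro i g
      simp only [mul_add, add_mul, mul_smul_comm, smul_mul_assoc, hLX, hLY, Finset.smul_sum,
        smul_smul, Matrix.add_apply, Matrix.smul_apply, add_smul, Finset.sum_add_distrib,
        smul_eq_mul]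

end Extraction

/-! ### Assembling two components into an isometry. -/

section Isometry

theorem exists_isometry_of_components {ι κ : Type u} {L : Fin 2 → Ell2 ι →L[ℂ] Ell2 κ}
    (hL : ∀ v, ∑ g, ‖L g v‖ ^ 2 = ‖v‖ ^ 2) :
    ∃ Λ : Ell2 ι →ₗᵢ[ℂ] Ell2 (Fin 2 × κ),
      ∀ g k f, matElem Λ.toContinuousLinearMap (g, k) f = matElem (L g) k f := by
  have hs : ∀ v, Summable fun z : Fin 2 × κ => ‖L z.1 v z.2‖ ^ 2 := fun v =>
    (summable_prod_of_nonneg fun _ => by simp only [Pi.zero_apply]; positivity).2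
      ⟨fun g => (hasSum_norm_sq (L g v)).summable, Summable.of_finite⟩
  refine ⟨⟨⟨⟨fun v => ⟨fun z => L z.1 v z.2, memℓp_two_of_summable (hs v)⟩, fun v w => ?_⟩,
    fun c v => ?_⟩, fun v => ?_⟩, fun g k f => rfl⟩
  · ext z; simp; rfl
  · ext z; simp
  · refine (sq_eq_sq₀ (norm_nonneg _) (norm_nonneg _)).1 ?_
    refine (hasSum_norm_sq (κ := Fin 2 × κ) _).unique ?_
    have h := (hs v).hasSum.prod_fiberwise fun g => hasSum_norm_sq (L g v)
    have h' := h.unique (hasSum_fintype _)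
    rw [hL v] at h'
    exact h' ▸ (hs v).hasSum

end Isometry

/-! ### Signs of the Svetlichny expression and sums over bit strings. -/

section Sign

/-- The sign `(-1) ^ (w (w + 1) / 2)` of the terms of `S_N^+`. -/
def svetlichnySign (w : ℕ) : ℝ := (-1) ^ (w * (w + 1) / 2)

theorem svetlichnySign_mul_self (w : ℕ) : svetlichnySign w * svetlichnySign w = 1 := by
  rw [svetlichnySign, ← mul_pow]; simp

theorem svetlichnySign_mul_succ (w : ℕ) :
    svetlichnySign w * svetlichnySign (w + 1) = (-1) ^ (w + 1) := by
  rw [svetlichnySign, svetlichnySign, ← pow_add]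
  -- Consecutive triangular numbers add up to a square, which has the parity of `w + 1`.
  have h : w * (w + 1) / 2 + (w + 1) * (w + 1 + 1) / 2 = (w + 1) * (w + 1) := by
    have h1 := Nat.div_two_mul_two_of_even (Nat.even_mul_succ_self w)
    have h2 := Nat.div_two_mul_two_of_even (Nat.even_mul_succ_self (w + 1))
    nlinarith
  rw [h, pow_mul]
  rcases neg_one_pow_eq_or ℝ (w + 1) with h | h <;> rw [h]
  · simp
  · have : Odd (w + 1) := neg_one_pow_eq_neg_one_iff_odd (by norm_num) |>.1 h
    exact this.neg_one_pow

theorem sum_neg_one_pow_weight {n : ℕ} (hn : n ≠ 0) :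
    ∑ x : Bits n, (-1 : ℝ) ^ weight x = 0 := by
  have h := Finset.prod_univ_sum (fun _ : Fin n => (Finset.univ : Finset (Fin 2)))
    fun _ b => (-1 : ℝ) ^ (b : ℕ)
  rw [Fintype.piFinset_univ] at h
  simp only [weight, ← Finset.prod_pow_eq_pow_sum, ← h]
  simp [hn]

theorem weight_cons {n : ℕ} (b : Fin 2) (x : Bits n) :
    weight (Fin.cons b x : Bits (n + 1)) = b + weight x := by
  simp [weight, Fin.sum_univ_succ]

theorem sum_bits_succ {n : ℕ} {M : Type*} [AddCommMonoid M] (F : Bits (n + 1) → M) :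
    ∑ x, F x = ∑ x : Bits n, (F (Fin.cons 0 x) + F (Fin.cons 1 x)) := by
  rw [← (Fin.consEquiv fun _ => Fin 2).sum_comp, Fintype.sum_prod_type_right]
  simp [Fin.consEquiv]

end Sign

/-! ### The sum-of-squares identity and its equality case. -/

section SumOfSquares

variable {H : Type*} [NormedAddCommGroup H] [InnerProductSpace ℂ H]

theorem norm_smul_add_smul_sub_sq (a b m : H) {c d : ℝ} (hc : c * c = 1) (hd : d * d = 1) :
    ‖(c : ℂ) • a + (d : ℂ) • b - ((√2 : ℝ) : ℂ) • m‖ ^ 2 =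
      ‖a‖ ^ 2 + ‖b‖ ^ 2 + 2 * (c * d) * (⟪a, b⟫_ℂ).re + 2 * ‖m‖ ^ 2 -
        2 * √2 * (c * (⟪a, m⟫_ℂ).re + d * (⟪b, m⟫_ℂ).re) := by
  have h2 : √2 ^ 2 = 2 := Real.sq_sqrt (by norm_num)
  have hc' : |c| ^ 2 = 1 := by rw [sq_abs, sq, hc]
  have hd' : |d| ^ 2 = 1 := by rw [sq_abs, sq, hd]
  rw [norm_sub_sq (𝕜 := ℂ), norm_add_sq (𝕜 := ℂ)]
  simp only [norm_smul, inner_smul_left, inner_smul_right, inner_add_left, Complex.conj_ofReal,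
    RCLike.re_eq_complex_re, Complex.re_ofReal_mul, Complex.add_re, mul_pow, Complex.norm_real,
    Real.norm_eq_abs, hc', hd', sq_abs, h2]
  ring

variable {n : ℕ} (a : Fin 2 → H) (m : Bits n → H)

/-- The Svetlichny operator as a sum of squares. -/
theorem svetlichny_sum_of_squares (hn : n ≠ 0) :
    ∑ x : Bits n, ‖(svetlichnySign (weight x) : ℂ) • a 0 +
        (svetlichnySign (weight x + 1) : ℂ) • a 1 - ((√2 : ℝ) : ℂ) • m x‖ ^ 2 +
      2 ^ n * ((1 - ‖a 0‖ ^ 2) + (1 - ‖a 1‖ ^ 2)) + 2 * ∑ x, (1 - ‖m x‖ ^ 2) =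
    2 * √2 * (2 ^ n * √2 - ∑ x : Bits n, (svetlichnySign (weight x) * (⟪a 0, m x⟫_ℂ).re +
      svetlichnySign (weight x + 1) * (⟪a 1, m x⟫_ℂ).re)) := by
  have h2 : √2 * √2 = 2 := Real.mul_self_sqrt (by norm_num)
  -- Half of the strings have even weight as soon as `n ≠ 0`, so the cross terms cancel.
  have h3 : ∑ x : Bits n, 2 * ((-1 : ℝ) ^ (weight x + 1)) * (⟪a 0, a 1⟫_ℂ).re = 0 := by
    rw [← Finset.sum_mul, ← Finset.mul_sum]
    simp only [pow_succ, ← Finset.sum_mul, sum_neg_one_pow_weight hn]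
    simp
  simp only [norm_smul_add_smul_sub_sq _ _ _ (svetlichnySign_mul_self _)
    (svetlichnySign_mul_self _), svetlichnySign_mul_succ, Finset.sum_sub_distrib,
    Finset.sum_add_distrib, h3, ← Finset.mul_sum, Finset.sum_const, Finset.card_univ,
    Fintype.card_fun, Fintype.card_fin, nsmul_eq_mul, Nat.cast_pow, Nat.cast_ofNat]
  linear_combination -(2 * 2 ^ n : ℝ) * h2

variable {a m}

theorem svetlichny_le_of_norm_le (hn : n ≠ 0) (ha : ∀ x, ‖a x‖ ≤ 1) (hm : ∀ x, ‖m x‖ ≤ 1) :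
    ∑ x : Bits n, (svetlichnySign (weight x) * (⟪a 0, m x⟫_ℂ).re +
      svetlichnySign (weight x + 1) * (⟪a 1, m x⟫_ℂ).re) ≤ 2 ^ n * √2 := by
  have h := svetlichny_sum_of_squares a m hn
  have h1 : ∀ v : H, ‖v‖ ≤ 1 → 0 ≤ 1 - ‖v‖ ^ 2 := fun v hv =>
    sub_nonneg.2 (pow_le_one₀ (norm_nonneg _) hv)
  have h2 : 0 < 2 * √2 := by positivity
  refine sub_nonneg.1 (nonneg_of_mul_nonneg_right (h ▸ ?_) h2)
  have := h1 _ (ha 0)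
  have := h1 _ (ha 1)
  have := Finset.sum_nonneg fun x (_ : x ∈ Finset.univ) => h1 _ (hm x)
  positivity

theorem eq_of_svetlichny_eq (hn : n ≠ 0) (ha : ∀ x, ‖a x‖ ≤ 1) (hm : ∀ x, ‖m x‖ ≤ 1)
    (hS : ∑ x : Bits n, (svetlichnySign (weight x) * (⟪a 0, m x⟫_ℂ).re +
      svetlichnySign (weight x + 1) * (⟪a 1, m x⟫_ℂ).re) = 2 ^ n * √2) :
    (∀ x, ‖a x‖ = 1) ∧ (∀ x, ‖m x‖ = 1) ∧
      ∀ x, (svetlichnySign (weight x) : ℂ) • a 0 + (svetlichnySign (weight x + 1) : ℂ) • a 1 =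
        ((√2 : ℝ) : ℂ) • m x := by
  have h := svetlichny_sum_of_squares a m hn
  have h1 : ∀ v : H, ‖v‖ ≤ 1 → 0 ≤ 1 - ‖v‖ ^ 2 := fun v hv =>
    sub_nonneg.2 (pow_le_one₀ (norm_nonneg _) hv)
  have h1' : ∀ v : H, 1 - ‖v‖ ^ 2 = 0 → ‖v‖ = 1 := fun v hv =>
    (pow_eq_one_iff_of_nonneg (norm_nonneg _) two_ne_zero).1 (by linarith)
  rw [hS, sub_self, mul_zero] at h
  have k0 := h1 _ (ha 0)
  have k1 := h1 _ (ha 1)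
  have k2 := Finset.sum_nonneg fun x (_ : x ∈ Finset.univ) => h1 _ (hm x)
  have k3 : 0 ≤ ∑ x : Bits n, ‖(svetlichnySign (weight x) : ℂ) • a 0 +
        (svetlichnySign (weight x + 1) : ℂ) • a 1 - ((√2 : ℝ) : ℂ) • m x‖ ^ 2 :=
    Finset.sum_nonneg fun _ _ => by positivity
  have k4 : 0 ≤ (2 : ℝ) ^ n * ((1 - ‖a 0‖ ^ 2) + (1 - ‖a 1‖ ^ 2)) := by positivity
  have k5 : (2 : ℝ) ^ n * ((1 - ‖a 0‖ ^ 2) + (1 - ‖a 1‖ ^ 2)) = 0 := by linarith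
  have k6 : (1 - ‖a 0‖ ^ 2) + (1 - ‖a 1‖ ^ 2) = 0 :=
    (mul_eq_zero.1 k5).resolve_left (by positivity)
  refine ⟨Fin.forall_fin_two.2 ⟨h1' _ (by linarith), h1' _ (by linarith)⟩, fun x => ?_,
    fun x => ?_⟩
  · have k7 : ∑ x, (1 - ‖m x‖ ^ 2) = 0 := by linarith
    exact h1' _ ((Finset.sum_eq_zero_iff_of_nonneg fun x _ => h1 _ (hm x)).1 k7 x
      (Finset.mem_univ x))
  · have k8 := (Finset.sum_eq_zero_iff_of_nonneg fun _ _ => by positivity).1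
      (le_antisymm (by linarith) k3) x (Finset.mem_univ x)
    exact sub_eq_zero.1 (norm_eq_zero.1 (pow_eq_zero_iff two_ne_zero |>.1 k8))

/-- Expand `‖A (A v) - v‖ ^ 2 = ‖A (A v)‖ ^ 2 - 2 ‖A v‖ ^ 2 + ‖v‖ ^ 2`, which is at most 0 for a
contraction that keeps the norm of `v`. -/
theorem apply_apply_eq_self_of_norm_eq [CompleteSpace H] {A : H →L[ℂ] H} (hA : IsSelfAdjoint A)
    (hA1 : ‖A‖ ≤ 1) {v : H} (hv : ‖A v‖ = ‖v‖) : A (A v) = v := by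
  refine sub_eq_zero.1 (norm_eq_zero.1 (pow_eq_zero_iff two_ne_zero |>.1
    (le_antisymm ?_ (sq_nonneg _))))
  have h1 : ‖A (A v)‖ ≤ ‖v‖ := by
    refine (A.le_opNorm _).trans ?_
    rw [hv]
    exact mul_le_of_le_one_left (norm_nonneg _) hA1
  have h2 : (⟪A (A v), v⟫_ℂ).re = ‖v‖ ^ 2 := by
    rw [← ContinuousLinearMap.adjoint_inner_right, ← ContinuousLinearMap.star_eq_adjoint,
      hA.star_eq, ← hv, ← inner_self_eq_norm_sq (𝕜 := ℂ)]
    rfl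
  have h3 : ‖A (A v)‖ ^ 2 ≤ ‖v‖ ^ 2 := pow_le_pow_left₀ (norm_nonneg _) h1 2
  rw [norm_sub_sq (𝕜 := ℂ), RCLike.re_eq_complex_re, h2]
  linarith

/-- `E` commutes with `F = 1 - E`, so `E F = E F E + F E F` is positive and `(E - F) ^ 2 = 1 - 4 E F
≤ 1`. No projective measurement is assumed, so this bound replaces involutivity. -/
theorem norm_sub_le_one_of_add_eq_one [CompleteSpace H] {E F : H →L[ℂ] H} (hE : E.IsPositive)
    (hF : F.IsPositive) (h : E + F = 1) : ‖E - F‖ ≤ 1 := by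
  have hE' := hE.isSelfAdjoint
  have hF' := hF.isSelfAdjoint
  have hF1 : F = 1 - E := eq_sub_of_add_eq' h
  have hEF : 0 ≤ E * F := by
    have h1 : E * F = E * F * E + F * E * F := by
      rw [hF1]; noncomm_ring
    rw [h1]
    refine add_nonneg ?_ ?_
    · simpa only [hE'.star_eq] using
        star_left_conjugate_nonneg (ContinuousLinearMap.nonneg_iff_isPositive F |>.2 hF) E
    · simpa only [hF'.star_eq] using
        star_left_conjugate_nonneg (ContinuousLinearMap.nonneg_iff_isPositive E |>.2 hE) F
  have h2 : star (E - F) * (E - F) ≤ 1 := by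
    have h3 : star (E - F) * (E - F) = 1 - (4 : ℝ) • (E * F) := by
      rw [(hE'.sub hF').star_eq, hF1, ofNat_smul_eq_nsmul]; noncomm_ring
    rw [h3]
    exact sub_le_self _ (smul_nonneg (by norm_num) hEF)
  have h4 := (CStarAlgebra.norm_le_one_iff_of_nonneg _ (star_mul_self_nonneg (E - F))).2 h2
  rw [CStarRing.norm_star_mul_self] at h4
  nlinarith [norm_nonneg (E - F)]

/-- The relations obeyed by two pairs of operators of different parties that are correlated as
`c x ψ = ± r b x ψ`. -/
theorem relations_of_correlated {c₀ c₁ b₀ b₁ r : H →L[ℂ] H} {ψ : H}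
    (h00 : Commute c₀ b₀) (h01 : Commute c₀ b₁) (h10 : Commute c₁ b₀) (h11 : Commute c₁ b₁)
    (hr0 : Commute c₀ r) (hr1 : Commute c₁ r) (kr0 : Commute b₀ r) (kr1 : Commute b₁ r)
    (hb0 : b₀ (b₀ ψ) = ψ) (hb1 : b₁ (b₁ ψ) = ψ) (hr : r (r ψ) = ψ)
    (h0 : c₀ ψ = r (b₀ ψ)) (h1 : c₁ ψ = -r (b₁ ψ)) :
    (c₀ (c₀ ψ) = ψ ∧ c₁ (c₁ ψ) = ψ ∧ c₀ (c₀ (c₁ ψ)) = c₁ ψ ∧ c₁ (c₁ (c₀ ψ)) = c₀ ψ) ∧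
      (b₀ (b₀ (b₁ ψ)) = b₁ ψ ∧ b₁ (b₁ (b₀ ψ)) = b₀ ψ) ∧
      (b₀ (b₁ ψ) = -c₁ (c₀ ψ) ∧ b₁ (b₀ ψ) = -c₀ (c₁ ψ)) := by
  replace h00 : ∀ v, c₀ (b₀ v) = b₀ (c₀ v) := fun v => congr($(h00.eq) v)
  replace h01 : ∀ v, c₀ (b₁ v) = b₁ (c₀ v) := fun v => congr($(h01.eq) v)
  replace h10 : ∀ v, c₁ (b₀ v) = b₀ (c₁ v) := fun v => congr($(h10.eq) v)
  replace h11 : ∀ v, c₁ (b₁ v) = b₁ (c₁ v) := fun v => congr($(h11.eq) v)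
  replace hr0 : ∀ v, c₀ (r v) = r (c₀ v) := fun v => congr($(hr0.eq) v)
  replace hr1 : ∀ v, c₁ (r v) = r (c₁ v) := fun v => congr($(hr1.eq) v)
  replace kr0 : ∀ v, b₀ (r v) = r (b₀ v) := fun v => congr($(kr0.eq) v)
  replace kr1 : ∀ v, b₁ (r v) = r (b₁ v) := fun v => congr($(kr1.eq) v)
  have e0 : b₀ ψ = r (c₀ ψ) := by rw [h0, ← kr0, ← kr0, hr]
  have e1 : b₁ ψ = -r (c₁ ψ) := by rw [h1, map_neg, neg_neg, ← kr1, ← kr1, hr]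
  have c00 : c₀ (c₀ ψ) = ψ := by
    rw [h0, hr0, h00, h0, kr0, hb0, hr]
  have c11 : c₁ (c₁ ψ) = ψ := by
    rw [h1, map_neg, hr1, h11, h1, map_neg, map_neg, neg_neg, kr1, hb1, hr]
  refine ⟨⟨c00, c11, ?_, ?_⟩, ⟨?_, ?_⟩, ?_, ?_⟩
  · rw [h1, map_neg, map_neg, hr0, hr0, h01, h01, c00]
  · rw [h0, hr1, hr1, h10, h10, c11]
  · rw [e1, map_neg, map_neg, kr0, kr0, ← h10, ← h10, hb0]
  · rw [e0, kr1, kr1, ← h01, ← h01, hb1]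
  · rw [e1, map_neg, kr0, ← h10, ← hr1, ← h0]
  · rw [e0, kr1, ← h01, ← hr0, h1, map_neg, neg_neg]

end SumOfSquares

/-! ### Maximal violation implies the GHZ stabilizer relations. -/

section Svetlichny

variable {n : ℕ} {ι : Fin (n + 1) → Type u} {P : Type u}

/-- The observables of all parties except the first one. -/
def otherObs (A : ∀ i, Fin 2 → Ell2 (ι i) →L[ℂ] Ell2 (ι i)) (x : Bits (n + 1)) (i : Fin (n + 1)) :
    Ell2 (ι i) →L[ℂ] Ell2 (ι i) :=
  if i = 0 then 1 else A i (x i)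

variable {A : ∀ i, Fin 2 → Ell2 (ι i) →L[ℂ] Ell2 (ι i)} {ψ : Ell2 ((∀ i, ι i) × P)}

theorem tensorOp_obs (x : Bits (n + 1)) :
    tensorOp (P := P) (fun i => A i (x i)) = localOp 0 (A 0 (x 0)) * tensorOp (otherObs A x) := by
  rw [← tensorOp_mulSingle, ← map_mul]
  congr 1
  ext1 i
  by_cases h : i = 0
  · subst h; simp [otherObs]
  · simp [otherObs, h]

theorem otherObs_cons (b : Fin 2) (x : Bits n) :
    otherObs A (Fin.cons b x) = otherObs A (Fin.cons 0 x) := by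
  ext1 i
  refine Fin.cases ?_ (fun i => ?_) i
  · simp [otherObs]
  · simp [otherObs]

/-- Grouping the inputs by the first party's bit brings the expression to the form of the
sum-of-squares identity. -/
theorem sum_svetlichnySign_inner (hA : ∀ i x, IsSelfAdjoint (A i x)) :
    ∑ x : Bits (n + 1), svetlichnySign (weight x) *
        (⟪ψ, tensorOp (fun i => A i (x i)) ψ⟫_ℂ).re =
      ∑ x : Bits n, (svetlichnySign (weight x) *
          (⟪localOp 0 (A 0 0) ψ, tensorOp (otherObs A (Fin.cons 0 x)) ψ⟫_ℂ).re +
        svetlichnySign (weight x + 1) *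
          (⟪localOp 0 (A 0 1) ψ, tensorOp (otherObs A (Fin.cons 0 x)) ψ⟫_ℂ).re) := by
  have h : ∀ x v, ⟪ψ, localOp 0 (A 0 x) v⟫_ℂ = ⟪localOp 0 (A 0 x) ψ, v⟫_ℂ := fun x v => by
    rw [← ContinuousLinearMap.adjoint_inner_left, ← ContinuousLinearMap.star_eq_adjoint,
      ← map_star, (hA 0 x).star_eq]
  rw [sum_bits_succ]
  refine Finset.sum_congr rfl fun x _ => ?_
  rw [tensorOp_obs, tensorOp_obs, otherObs_cons 1 x, weight_cons, weight_cons]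
  simp only [mul_apply_eq_comp, h, Fin.cons_zero, Fin.val_zero, zero_add, Fin.val_one]
  rw [add_comm 1]

theorem norm_localOp_apply_le {i : Fin (n + 1)} {B : Ell2 (ι i) →L[ℂ] Ell2 (ι i)} (hB : ‖B‖ ≤ 1) :
    ‖localOp i B ψ‖ ≤ ‖ψ‖ :=
  (ContinuousLinearMap.le_opNorm _ _).trans <| mul_le_of_le_one_left (norm_nonneg _) <|
    (NonUnitalStarAlgHom.norm_apply_le (localOp i) B).trans hB

theorem norm_tensorOp_apply_le {B : ∀ i, Ell2 (ι i) →L[ℂ] Ell2 (ι i)} (hB : ∀ i, ‖B i‖ ≤ 1) :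
    ‖tensorOp B ψ‖ ≤ ‖ψ‖ :=
  (ContinuousLinearMap.le_opNorm _ _).trans <| mul_le_of_le_one_left (norm_nonneg _) <|
    norm_tensorOp_le hB

theorem norm_otherObs_le (hA1 : ∀ i x, ‖A i x‖ ≤ 1) (x : Bits (n + 1)) (i : Fin (n + 1)) :
    ‖otherObs A x i‖ ≤ 1 := by
  rw [otherObs]
  split_ifs
  · exact ContinuousLinearMap.norm_id_le
  · exact hA1 _ _

theorem sum_svetlichnySign_inner_le (hn : n ≠ 0) (hA : ∀ i x, IsSelfAdjoint (A i x))
    (hA1 : ∀ i x, ‖A i x‖ ≤ 1) (hψ : ‖ψ‖ = 1) :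
    ∑ x : Bits (n + 1), svetlichnySign (weight x) *
        (⟪ψ, tensorOp (fun i => A i (x i)) ψ⟫_ℂ).re ≤ 2 ^ n * √2 := by
  rw [sum_svetlichnySign_inner hA]
  exact svetlichny_le_of_norm_le (a := fun x => localOp 0 (A 0 x) ψ) hn
    (fun x => hψ ▸ norm_localOp_apply_le (hA1 0 x))
    fun x => hψ ▸ norm_tensorOp_apply_le (norm_otherObs_le hA1 _)

/-- The observable that is to become `σ_x`. -/
def fstPauli (A : ∀ i, Fin 2 → Ell2 (ι i) →L[ℂ] Ell2 (ι i)) (i : Fin (n + 1)) :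
    Ell2 (ι i) →L[ℂ] Ell2 (ι i) :=
  if i = 0 then ((1 / √2 : ℝ) : ℂ) • (A i 0 - A i 1) else A i 0

/-- The observable that is to become `σ_y`. -/
def sndPauli (A : ∀ i, Fin 2 → Ell2 (ι i) →L[ℂ] Ell2 (ι i)) (i : Fin (n + 1)) :
    Ell2 (ι i) →L[ℂ] Ell2 (ι i) :=
  if i = 0 then ((1 / √2 : ℝ) : ℂ) • (A i 0 + A i 1) else A i 1

theorem isSelfAdjoint_fstPauli (hA : ∀ i x, IsSelfAdjoint (A i x)) (i : Fin (n + 1)) :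
    IsSelfAdjoint (fstPauli A i) := by
  rw [fstPauli]
  split_ifs
  · exact (isSelfAdjoint_iff.2 (Complex.conj_ofReal _)).smul ((hA i 0).sub (hA i 1))
  · exact hA i 0

theorem isSelfAdjoint_sndPauli (hA : ∀ i x, IsSelfAdjoint (A i x)) (i : Fin (n + 1)) :
    IsSelfAdjoint (sndPauli A i) := by
  rw [sndPauli]
  split_ifs
  · exact (isSelfAdjoint_iff.2 (Complex.conj_ofReal _)).smul ((hA i 0).add (hA i 1))
  · exact hA i 1

theorem localOp_commute_tensorOp (i : Fin (n + 1)) (B : Ell2 (ι i) →L[ℂ] Ell2 (ι i))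
    (C : ∀ i, Ell2 (ι i) →L[ℂ] Ell2 (ι i)) (hC : C i = 1) :
    Commute (localOp (P := P) i B) (tensorOp C) := by
  rw [← tensorOp_mulSingle]
  refine Commute.map ?_ tensorOp
  refine funext fun j => ?_
  by_cases h : j = i
  · subst h; simp [hC]
  · simp [h]

theorem eq_inv_sqrt_two_smul {H : Type*} [AddCommGroup H] [Module ℂ H] {v w : H}
    (h : v = ((√2 : ℝ) : ℂ) • w) : ((1 / √2 : ℝ) : ℂ) • v = w := by
  rw [h, smul_smul, ← Complex.ofReal_mul, one_div, inv_mul_cancel₀ (by positivity)]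
  simp

theorem otherObs_eq_update_mul (x : Bits (n + 1)) (j : Fin n) :
    otherObs A x =
      Function.update (otherObs A x) j.succ 1 * Pi.mulSingle j.succ (A j.succ (x j.succ)) := by
  ext1 i
  by_cases h : i = j.succ
  · subst h; simp [otherObs]
  · simp [h]

theorem tensorOp_otherObs_apply (x : Bits (n + 1)) (j : Fin n) :
    tensorOp (otherObs A x) ψ = tensorOp (Function.update (otherObs A x) j.succ 1)
      (localOp j.succ (A j.succ (x j.succ)) ψ) := by
  rw [← tensorOp_mulSingle, ← mul_apply_eq_comp, ← map_mul, ← otherObs_eq_update_mul]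

theorem update_otherObs_single (j : Fin n) :
    Function.update (otherObs A (Fin.cons 0 (Pi.single j 1))) j.succ 1 =
      Function.update (otherObs A (Fin.cons 0 0)) j.succ 1 := by
  ext1 i
  by_cases hi : i = j.succ
  · subst hi; simp
  · rw [Function.update_of_ne hi, Function.update_of_ne hi]
    refine Fin.cases (fun _ => ?_) (fun k hk => ?_) i hi
    · simp [otherObs]
    · have : k ≠ j := fun h => hk (h ▸ rfl)
      simp [otherObs, this]

theorem weight_single (j : Fin n) : weight (Pi.single j 1 : Bits n) = 1 := by
  rw [weight, Finset.sum_eq_single j] <;> simp +contextual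

theorem norm_update_otherObs_le (hA1 : ∀ i x, ‖A i x‖ ≤ 1) (x : Bits (n + 1)) (j : Fin n)
    (i : Fin (n + 1)) : ‖Function.update (otherObs A x) j.succ 1 i‖ ≤ 1 := by
  by_cases hi : i = j.succ
  · subst hi; rw [Function.update_self]; exact ContinuousLinearMap.norm_id_le
  · rw [Function.update_of_ne hi]; exact norm_otherObs_le hA1 _ _

/-- A product of contractions that preserves the norm of `ψ` has only factors that preserve it. For
a party other than the first, the constant string `x` supplies such a product. -/
theorem localOp_obs_localOp_obs (hA : ∀ i x, IsSelfAdjoint (A i x)) (hA1 : ∀ i x, ‖A i x‖ ≤ 1)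
    (ha : ∀ x, ‖localOp 0 (A 0 x) ψ‖ = ‖ψ‖)
    (hm : ∀ x : Bits n, ‖tensorOp (otherObs A (Fin.cons 0 x)) ψ‖ = ‖ψ‖) (i : Fin (n + 1))
    (x : Fin 2) : localOp i (A i x) (localOp i (A i x) ψ) = ψ := by
  refine apply_apply_eq_self_of_norm_eq ((hA i x).map (localOp i))
    ((NonUnitalStarAlgHom.norm_apply_le (localOp i) _).trans (hA1 i x)) ?_
  refine Fin.cases ha (fun j x => ?_) i x
  refine le_antisymm (norm_localOp_apply_le (hA1 _ _)) ?_
  have h := hm fun _ => x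
  rw [tensorOp_otherObs_apply _ j, Fin.cons_succ] at h
  rw [← h]
  exact norm_tensorOp_apply_le (norm_update_otherObs_le hA1 _ _)

theorem tensorOp_update_otherObs_sq (hinv : ∀ i x, localOp i (A i x) (localOp i (A i x) ψ) = ψ)
    (x : Bits (n + 1)) (j : Fin n) :
    tensorOp (Function.update (otherObs A x) j.succ 1)
      (tensorOp (Function.update (otherObs A x) j.succ 1) ψ) = ψ := by
  rw [← mul_apply_eq_comp, ← map_mul]
  refine tensorOp_eq_self fun i => ?_
  rw [Pi.mul_apply, map_mul, mul_apply_eq_comp]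
  by_cases hi : i = j.succ
  · subst hi; simp
  · rw [Function.update_of_ne hi, otherObs]
    split_ifs
    · simp
    · exact hinv _ _

theorem fstPauli_succ (j : Fin n) : fstPauli A j.succ = A j.succ 0 := by simp [fstPauli]

theorem sndPauli_succ (j : Fin n) : sndPauli A j.succ = A j.succ 1 := by simp [sndPauli]

theorem localOp_fstPauli_apply (v : Ell2 ((∀ i, ι i) × P)) : localOp 0 (fstPauli A 0) v =
    ((1 / √2 : ℝ) : ℂ) • (localOp 0 (A 0 0) v - localOp 0 (A 0 1) v) := by
  rw [fstPauli, if_pos rfl, map_smul, map_sub]; rfl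

theorem localOp_sndPauli_apply (v : Ell2 ((∀ i, ι i) × P)) : localOp 0 (sndPauli A 0) v =
    ((1 / √2 : ℝ) : ℂ) • (localOp 0 (A 0 0) v + localOp 0 (A 0 1) v) := by
  rw [sndPauli, if_pos rfl, map_smul, map_add]; rfl

/-- The anticommutator of the sum and the difference is a multiple of `A₀² - A₁²`, which kills `ψ`.
-/
theorem localOp_pauli_anticomm (hinv : ∀ x, localOp 0 (A 0 x) (localOp 0 (A 0 x) ψ) = ψ) :
    localOp 0 (sndPauli A 0) (localOp 0 (fstPauli A 0) ψ) =
      -localOp 0 (fstPauli A 0) (localOp 0 (sndPauli A 0) ψ) := by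
  simp only [localOp_fstPauli_apply, localOp_sndPauli_apply, map_smul, map_sub, map_add, hinv]
  module

theorem tensorOp_fstPauli : tensorOp (P := P) (fstPauli A) =
    localOp 0 (fstPauli A 0) * tensorOp (otherObs A (Fin.cons 0 0)) := by
  rw [← tensorOp_mulSingle, ← map_mul]
  congr 1
  ext1 i
  refine Fin.cases ?_ (fun j => ?_) i
  · simp [otherObs]
  · simp [otherObs, fstPauli]

theorem exists_ghz_components_of_svetlichny (hn : n ≠ 0) (hA : ∀ i x, IsSelfAdjoint (A i x))
    (hA1 : ∀ i x, ‖A i x‖ ≤ 1) (hψ : ‖ψ‖ = 1)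
    (hS : ∑ x : Bits (n + 1), svetlichnySign (weight x) *
        (⟪ψ, tensorOp (fun i => A i (x i)) ψ⟫_ℂ).re = 2 ^ n * √2) :
    ∃ (L : ∀ i, Fin 2 → Ell2 (ι i) →L[ℂ] Ell2 (ι i)) (ζ : Ell2 ((∀ i, ι i) × P)),
      (∀ i, ∑ g, star (L i g) * L i g = 1) ∧ ‖ζ‖ = 1 ∧
      (∀ g : Bits (n + 1), tensorOp (fun i => L i (g i)) ψ = ghz (n + 1) g • ζ) ∧
      ∀ (c d : Fin (n + 1) → ℂ) (g : Bits (n + 1)),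
        tensorOp (fun i => L i (g i)) (tensorOp (fun i => c i • fstPauli A i + d i • sndPauli A i)
          ψ) = qubitApply (fun i => c i • σx + d i • σy) (ghz (n + 1)) g • ζ := by
  rw [sum_svetlichnySign_inner hA] at hS
  obtain ⟨ha, hm, hD⟩ := eq_of_svetlichny_eq (a := fun x => localOp 0 (A 0 x) ψ) hn
    (fun x => hψ ▸ norm_localOp_apply_le (hA1 0 x))
    (fun x => hψ ▸ norm_tensorOp_apply_le (norm_otherObs_le hA1 _)) hS
  rw [← hψ] at ha hm
  have hinv := localOp_obs_localOp_obs hA hA1 ha hm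
  set c₀ := localOp (P := P) 0 (fstPauli A 0) with hc₀
  set c₁ := localOp (P := P) 0 (sndPauli A 0) with hc₁
  set r : Fin n → _ := fun j =>
    tensorOp (P := P) (Function.update (otherObs A (Fin.cons 0 0)) j.succ 1) with hr
  -- The zero string: weights 0 and 1 carry the signs `1` and `-1`, giving the difference of the
  -- first party's observables.
  have h0 : c₀ ψ = tensorOp (otherObs A (Fin.cons 0 0)) ψ := by
    rw [← eq_inv_sqrt_two_smul (hD 0), hc₀, localOp_fstPauli_apply]
    simp [weight, svetlichnySign, sub_eq_add_neg]
  have h0' : ∀ j, c₀ ψ = r j (localOp j.succ (A j.succ 0) ψ) := fun j => by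
    rw [h0, tensorOp_otherObs_apply _ j, Fin.cons_succ]
    rfl
  -- The string with a single 1 at `j`: weights 1 and 2 both carry the sign `-1`, giving minus the
  -- sum.
  have h1' : ∀ j, c₁ ψ = -r j (localOp j.succ (A j.succ 1) ψ) := fun j => by
    have h := eq_inv_sqrt_two_smul (hD (Pi.single j 1))
    rw [tensorOp_otherObs_apply _ j, update_otherObs_single, weight_single, Fin.cons_succ,
      Pi.single_eq_same] at h
    simp only [hr]
    rw [← h, hc₁, localOp_sndPauli_apply]
    simp only [svetlichnySign]
    norm_num
    module
  have hrr : ∀ j, r j (r j ψ) = ψ := fun j => tensorOp_update_otherObs_sq hinv _ j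
  have hanti : c₁ (c₀ ψ) = -c₀ (c₁ ψ) := localOp_pauli_anticomm (hinv 0)
  have key := fun j : Fin n => relations_of_correlated (c₀ := c₀) (c₁ := c₁)
    (localOp_commute (Fin.succ_ne_zero j).symm _ (A j.succ 0))
    (localOp_commute (Fin.succ_ne_zero j).symm _ (A j.succ 1))
    (localOp_commute (Fin.succ_ne_zero j).symm _ (A j.succ 0))
    (localOp_commute (Fin.succ_ne_zero j).symm _ (A j.succ 1))
    (localOp_commute_tensorOp 0 _ _ (by simp [otherObs, (Fin.succ_ne_zero j).symm]))
    (localOp_commute_tensorOp 0 _ _ (by simp [otherObs, (Fin.succ_ne_zero j).symm]))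
    (localOp_commute_tensorOp j.succ _ _ (by simp))
    (localOp_commute_tensorOp j.succ _ _ (by simp))
    (hinv _ _) (hinv _ _) (hrr j) (h0' j) (h1' j)
  -- One other party, which exists since `n ≠ 0`, suffices to certify the relations of the first
  -- one.
  obtain ⟨⟨hc00, hc11, hc001, hc110⟩, -⟩ := key ⟨0, by omega⟩
  refine exists_ghz_components (φ := c₀ (c₁ ψ)) n.succ_ne_zero (isSelfAdjoint_fstPauli hA)
    (isSelfAdjoint_sndPauli hA) hψ (Fin.cases hc00 fun j => ?_) (Fin.cases hc11 fun j => ?_)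
    (Fin.cases hanti fun j => ?_) (Fin.cases hc001 fun j => ?_) (Fin.cases hc110 fun j => ?_)
    (Fin.cases rfl fun j => ?_) ?_
  · rw [tensorOp_fstPauli, mul_apply_eq_comp, ← h0]
    exact hc00
  · rw [fstPauli_succ, hinv]
  · rw [sndPauli_succ, hinv]
  · rw [fstPauli_succ, sndPauli_succ, (key j).2.2.1, (key j).2.2.2, hanti, neg_neg]
  · rw [fstPauli_succ, sndPauli_succ, (key j).2.1.1]
  · rw [fstPauli_succ, sndPauli_succ, (key j).2.1.2]
  · rw [fstPauli_succ, sndPauli_succ, (key j).2.2.1, hanti, neg_neg]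

end Svetlichny

/-! ### From realizations to signed observables, and the quantum bound. -/

section Realization

theorem inv_sqrt_two_mul_self : ((1 / √2 : ℝ) : ℂ) * ((1 / √2 : ℝ) : ℂ) = 1 / 2 := by
  rw [← Complex.ofReal_mul, one_div, ← mul_inv, Real.mul_self_sqrt (by norm_num)]
  norm_num

/-- Passing from `S_N^+` to `S_N^-` lowers the exponent by `w`. The resulting factor `s ^ w` is what
`prod_targetSign` contributes when input-1 observables are multiplied by `s`. -/
theorem zpow_div_two_eq (s : ℤˣ) (w : ℕ) :
    (-1 : ℝ) ^ (((w : ℤ) * ((w : ℤ) + (s : ℤ))) / 2) = ((s : ℤ) : ℝ) ^ w * svetlichnySign w := by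
  rw [svetlichnySign]
  rcases Int.units_eq_one_or s with rfl | rfl
  · have : ((w : ℤ) * ((w : ℤ) + ((1 : ℤˣ) : ℤ))) / 2 = ((w * (w + 1) / 2 : ℕ) : ℤ) := by
      push_cast; rfl
    rw [this, zpow_natCast]
    simp
  · have : ((w : ℤ) * ((w : ℤ) + ((-1 : ℤˣ) : ℤ))) / 2 = ((w * (w + 1) / 2 : ℕ) : ℤ) - w := by
      have h : (w : ℤ) * ((w : ℤ) + ((-1 : ℤˣ) : ℤ)) = w * (w + 1) + (-w) * 2 := by
        push_cast; ring
      rw [h, Int.add_mul_ediv_right _ _ two_ne_zero]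
      push_cast; ring
    rw [this, zpow_sub₀ (by norm_num), zpow_natCast, zpow_natCast]
    rcases neg_one_pow_eq_or ℝ w with h | h <;> simp [h, div_neg]

theorem correlator_eq_sum {N : ℕ} (p : Behaviour N) (x : Bits N) :
    correlator p x = ∑ a : Bits N, (-1 : ℝ) ^ weight a * p a x := by
  rw [correlator, Finset.sum_filter, Finset.sum_filter, ← Finset.sum_sub_distrib]
  refine Finset.sum_congr rfl fun a _ => ?_
  rcases Nat.mod_two_eq_zero_or_one (weight a) with h | h
  · simp [h, (Nat.even_iff.2 h).neg_one_pow]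
  · simp [h, (Nat.odd_iff.2 h).neg_one_pow]

variable {N : ℕ} {R : Realization.{u} N} {p : Behaviour N}

theorem Realization.Compatible.inner_eq (h : R.Compatible p) (a x : Bits N) :
    ⟪R.ψ, tensorOp (fun i => R.E i (x i) (a i)) R.ψ⟫_ℂ = p a x := by
  rw [h, lp.inner_eq_tsum, tensorApply_eq]
  simp [mul_comm]

theorem Realization.tensorOp_obs_eq_sum (x : Bits N) :
    tensorOp (P := R.P) (fun i => R.obs i (x i)) =
      ∑ a : Bits N, ((-1 : ℂ) ^ weight a) • tensorOp fun i => R.E i (x i) (a i) := by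
  have h := tensorOp_sum (P := R.P) (fun (_ : Fin N) (a : Fin 2) => (-1 : ℂ) ^ (a : ℕ))
    fun i a => R.E i (x i) a
  simp only [Finset.prod_pow_eq_pow_sum] at h
  have h1 : (fun i => R.obs i (x i)) =
      fun i => ∑ a : Fin 2, (-1 : ℂ) ^ (a : ℕ) • R.E i (x i) a := by
    ext1 i
    simp [Realization.obs, Fin.sum_univ_two, sub_eq_add_neg]
  rw [h1]
  exact h

theorem Realization.Compatible.correlator_eq (h : R.Compatible p) (x : Bits N) :
    correlator p x = (⟪R.ψ, tensorOp (fun i => R.obs i (x i)) R.ψ⟫_ℂ).re := by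
  rw [correlator_eq_sum, R.tensorOp_obs_eq_sum, sum_apply, inner_sum, Complex.re_sum]
  refine Finset.sum_congr rfl fun a _ => ?_
  rw [smul_apply, inner_smul_right, h.inner_eq]
  norm_cast

/-- The observables with the signs of the target observables removed. -/
def Realization.signedObs (R : Realization.{u} N) (s ε : ℤˣ) (i : Fin N) (x : Fin 2) :
    Ell2 (R.ι i) →L[ℂ] Ell2 (R.ι i) :=
  targetSign s ε i x • R.obs i x

theorem targetSign_eq (s ε : ℤˣ) (i : Fin N) (x : Fin 2) :
    targetSign s ε i x = (((s ^ (x : ℕ) * if (i : ℕ) = 0 then ε else 1 : ℤˣ) : ℤ) : ℂ) := by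
  rw [targetSign]
  split_ifs <;> push_cast <;> rfl

theorem targetSign_eq_one_or (s ε : ℤˣ) (i : Fin N) (x : Fin 2) :
    targetSign s ε i x = 1 ∨ targetSign s ε i x = -1 := by
  rw [targetSign_eq]
  rcases Int.units_eq_one_or (s ^ (x : ℕ) * if (i : ℕ) = 0 then ε else 1) with h | h <;> simp [h]

theorem targetSign_mul_self (s ε : ℤˣ) (i : Fin N) (x : Fin 2) :
    targetSign s ε i x * targetSign s ε i x = 1 := by
  rcases targetSign_eq_one_or s ε i x with h | h <;> simp [h]

theorem isSelfAdjoint_signedObs (s ε : ℤˣ) (i : Fin N) (x : Fin 2) :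
    IsSelfAdjoint (R.signedObs s ε i x) := by
  have h := (R.E_pos i x 0).isSelfAdjoint.sub (R.E_pos i x 1).isSelfAdjoint
  rw [Realization.signedObs, Realization.obs]
  rcases targetSign_eq_one_or s ε i x with h' | h'
  · rwa [h', one_smul]
  · rw [h', neg_one_smul]; exact h.neg

theorem norm_signedObs_le (s ε : ℤˣ) (i : Fin N) (x : Fin 2) : ‖R.signedObs s ε i x‖ ≤ 1 := by
  have h := norm_sub_le_one_of_add_eq_one (R.E_pos i x 0) (R.E_pos i x 1) (R.E_sum i x)
  rw [Realization.signedObs, Realization.obs, norm_smul]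
  rcases targetSign_eq_one_or s ε i x with h' | h' <;> simpa [h'] using h

theorem prod_targetSign {n : ℕ} (s ε : ℤˣ) (x : Bits (n + 1)) :
    ∏ i, targetSign s ε i (x i) = ((s : ℤ) : ℂ) ^ weight x * ((ε : ℤ) : ℂ) := by
  simp only [targetSign, Finset.prod_mul_distrib, Finset.prod_pow_eq_pow_sum, weight]
  congr 1
  simp

theorem Realization.Compatible.svetlichny_eq {n : ℕ} {R : Realization.{u} (n + 1)}
    {p : Behaviour (n + 1)} (h : R.Compatible p) (s ε : ℤˣ) :
    ∑ x : Bits (n + 1), svetlichnySign (weight x) *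
        (⟪R.ψ, tensorOp (fun i => R.signedObs s ε i (x i)) R.ψ⟫_ℂ).re =
      ((ε : ℤ) : ℝ) * svetlichny s p := by
  rw [svetlichny, Finset.mul_sum]
  refine Finset.sum_congr rfl fun x _ => ?_
  simp only [Realization.signedObs]
  rw [tensorOp_smul (fun i => targetSign s ε i (x i)) fun i => R.obs i (x i), prod_targetSign,
    smul_apply, inner_smul_right, h.correlator_eq, zpow_div_two_eq]
  have : (((s : ℤ) : ℂ) ^ weight x * ((ε : ℤ) : ℂ)) =
      ((((s : ℤ) : ℝ) ^ weight x * ((ε : ℤ) : ℝ) : ℝ) : ℂ) := by push_cast; rfl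
  rw [this, Complex.re_ofReal_mul]
  ring

theorem abs_svetlichny_le {n : ℕ} (hn : n ≠ 0) (s : ℤˣ) {p : Behaviour (n + 1)}
    (hp : IsQuantum.{u} p) : |svetlichny s p| ≤ 2 ^ n * √2 := by
  obtain ⟨R, hR⟩ := hp
  have h := fun ε => sum_svetlichnySign_inner_le (A := R.signedObs s ε) hn
    (isSelfAdjoint_signedObs s ε) (norm_signedObs_le s ε) R.norm_ψ
  simp only [hR.svetlichny_eq] at h
  have h1 := h 1
  have h2 := h (-1)
  simp only [Units.val_one, Units.val_neg, Int.cast_one, Int.cast_neg, one_mul,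
    neg_one_mul] at h1 h2
  exact abs_le.2 ⟨by linarith, h1⟩

/-- The coefficient of `σ_x` in the target observables. -/
def fstCoeff (s ε : ℤˣ) (i : Fin N) (x : Fin 2) : ℂ :=
  targetSign s ε i x * if (i : ℕ) = 0 then ((1 / √2 : ℝ) : ℂ) * (if x = 0 then 1 else -1)
    else if x = 0 then 1 else 0

/-- The coefficient of `σ_y` in the target observables. -/
def sndCoeff (s ε : ℤˣ) (i : Fin N) (x : Fin 2) : ℂ :=
  targetSign s ε i x * if (i : ℕ) = 0 then ((1 / √2 : ℝ) : ℂ) else if x = 0 then 0 else 1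

theorem ghzObs_eq (s ε : ℤˣ) (i : Fin N) (x : Fin 2) :
    ghzObs s ε i x = fstCoeff s ε i x • σx + sndCoeff s ε i x • σy := by
  rw [ghzObs, fstCoeff, sndCoeff]
  split_ifs
  · module
  · module
  · simp
  · simp

/-- This inverts the rotation that defines `fstPauli` and `sndPauli`, with the same coefficients as
in `ghzObs_eq`; the real observables therefore map exactly to the targets. -/
theorem Realization.obs_eq {n : ℕ} (R : Realization.{u} (n + 1)) (s ε : ℤˣ) (i : Fin (n + 1))
    (x : Fin 2) :
    R.obs i x = fstCoeff s ε i x • fstPauli (R.signedObs s ε) i +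
      sndCoeff s ε i x • sndPauli (R.signedObs s ε) i := by
  have h1 : R.obs i x = targetSign s ε i x • R.signedObs s ε i x := by
    rw [Realization.signedObs, smul_smul, targetSign_mul_self, one_smul]
  have h2 := inv_sqrt_two_mul_self
  rw [h1, fstPauli, sndPauli, fstCoeff, sndCoeff]
  simp only [Fin.val_eq_zero_iff]
  have hx : x = 0 ∨ x = 1 := by omega
  generalize targetSign s ε i x = t
  generalize ((1 / √2 : ℝ) : ℂ) = r at h2
  by_cases hi : i = 0 <;> rcases hx with rfl | rfl <;>
    simp only [hi, if_true, if_false, smul_smul, mul_one, one_ne_zero, mul_zero, zero_smul,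
      add_zero, zero_add, mul_assoc, h2, mul_neg, neg_mul]
  · module
  · module

end Realization

/-! ### Self-testing in the GHZ frame and in the graph state frame. -/

section SelfTest

theorem sum_norm_sq_of_sum_star_mul_self {H : Type*} [NormedAddCommGroup H]
    [InnerProductSpace ℂ H] [CompleteSpace H] {L : Fin 2 → H →L[ℂ] H}
    (hL : ∑ g, star (L g) * L g = 1) (v : H) : ∑ g, ‖L g v‖ ^ 2 = ‖v‖ ^ 2 := by
  have h : ∀ g, ‖L g v‖ ^ 2 = (⟪v, (star (L g) * L g) v⟫_ℂ).re := fun g => by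
    rw [mul_apply_eq_comp, ContinuousLinearMap.star_eq_adjoint,
      ContinuousLinearMap.adjoint_inner_right, ← inner_self_eq_norm_sq (𝕜 := ℂ)]
    rfl
  simp only [h]
  rw [← Complex.re_sum, ← inner_sum, ← sum_apply, hL, ← inner_self_eq_norm_sq (𝕜 := ℂ)]
  rfl

theorem sum_star_mul_self_of_unitary {B : Type*} [Ring B] [StarRing B] [Algebra ℂ B]
    [StarModule ℂ B] {L : Fin 2 → B} (hL : ∑ g, star (L g) * L g = 1)
    {U : Matrix (Fin 2) (Fin 2) ℂ} (hU : Uᴴ * U = 1) :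
    ∑ g, star (∑ h, U g h • L h) * ∑ h, U g h • L h = 1 := by
  have h : ∀ h k, ∑ g, star (U g h) * U g k = (1 : Matrix (Fin 2) (Fin 2) ℂ) h k := fun h k => by
    rw [← hU, Matrix.mul_apply]; rfl
  simp only [star_sum, star_smul, Finset.sum_mul_sum, smul_mul_smul_comm]
  rw [Finset.sum_comm, ← hL]
  refine Finset.sum_congr rfl fun k _ => ?_
  rw [Finset.sum_comm]
  simp only [← Finset.sum_smul, h, Matrix.one_apply, ite_smul, one_smul, zero_smul,
    Finset.sum_ite_eq, Finset.mem_univ, if_true]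

/-- Rotating the extracted qubits by `U i` carries the GHZ self-test to any locally equivalent
frame, so both targets come from one extraction. -/
theorem selfTests_of_frame {n : ℕ} (hn : n ≠ 0) {s ε : ℤˣ} {p : Behaviour (n + 1)}
    (hp : svetlichny s p = ((ε : ℤ) : ℝ) * (2 ^ n * √2))
    {U : Fin (n + 1) → Matrix (Fin 2) (Fin 2) ℂ} (hU : ∀ i, (U i)ᴴ * U i = 1)
    {Φ : Qubits (n + 1)} (hΦ : qubitApply U (ghz (n + 1)) = Φ)
    {B : Fin (n + 1) → Fin 2 → Matrix (Fin 2) (Fin 2) ℂ}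
    (hB : ∀ i x, B i x * U i = U i * ghzObs s ε i x) :
    SelfTests.{u} p Φ B := by
  intro R hR
  have hS := hR.svetlichny_eq s ε
  have hεε : ((ε : ℤ) : ℝ) * ((ε : ℤ) : ℝ) = 1 := by
    rcases Int.units_eq_one_or ε with rfl | rfl <;> simp
  rw [hp, ← mul_assoc, hεε, one_mul] at hS
  obtain ⟨L, ζ, hL, hζ, hψ, hobs⟩ := exists_ghz_components_of_svetlichny
    (A := R.signedObs s ε) hn (isSelfAdjoint_signedObs s ε) (norm_signedObs_le s ε) R.norm_ψ hS
  have hL' := fun i => sum_star_mul_self_of_unitary (hL i) (hU i)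
  choose Λ hΛ using fun i =>
    exists_isometry_of_components (sum_norm_sq_of_sum_star_mul_self (hL' i))
  have key : ∀ (φ : Ell2 ((∀ i, R.ι i) × R.P)) (F : Qubits (n + 1)),
      (∀ g : Bits (n + 1), tensorOp (fun i => L i (g i)) φ = F g • ζ) →
      ∀ (g : ∀ i, Fin 2 × R.ι i) (q : R.P),
        tensorApply (fun i => (Λ i).toContinuousLinearMap) φ (g, q) =
          qubitApply U F (fun i => (g i).1) * ζ (fun i => (g i).2, q) := by
    intro φ F hF g q
    have h1 : tensorApply (fun i => (Λ i).toContinuousLinearMap) φ (g, q) =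
        tensorApply (fun i => ∑ h, U i (g i).1 h • L i h) φ (fun i => (g i).2, q) := by
      simp only [tensorApply]
      refine tsum_congr fun f => ?_
      congr 1
      exact Finset.prod_congr rfl fun i _ => hΛ i _ _ _
    rw [h1, tensorApply_eq, tensorOp_sum]
    simp only [sum_apply, smul_apply, hF, smul_smul, ← Finset.sum_smul]
    rfl
  -- The components are operators of the local space into itself, so each residual space is a copy
  -- of that local space.
  refine ⟨R.ι, Λ, ζ, hζ, fun g q => ?_, fun x g q => ?_⟩
  · rw [key R.ψ _ hψ, hΦ]
  · have h1 := hobs (fun i => fstCoeff s ε i (x i)) (fun i => sndCoeff s ε i (x i))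
    simp only [← R.obs_eq, ← ghzObs_eq] at h1
    rw [tensorApply_eq, key _ _ h1, ← hΦ, qubitApply_qubitApply, qubitApply_qubitApply]
    simp only [hB]

theorem selfTests_ghz {n : ℕ} (hn : n ≠ 0) {s ε : ℤˣ} {p : Behaviour (n + 1)}
    (hp : svetlichny s p = ((ε : ℤ) : ℝ) * (2 ^ n * √2)) :
    SelfTests.{u} p (ghz (n + 1)) (ghzObs s ε) :=
  selfTests_of_frame hn hp (U := fun _ => 1) (by simp) (qubitApply_one _) (by simp)

/-- The local unitaries that map the GHZ state to the fully connected graph state. -/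
def graphFrame {N : ℕ} (i : Fin N) : Matrix (Fin 2) (Fin 2) ℂ :=
  if (i : ℕ) = 0 then ((1 - Complex.I) / 2) • !![1, Complex.I; Complex.I, 1]
  else ((1 / √2 : ℝ) : ℂ) • !![1, 1; Complex.I, -Complex.I]

theorem graphFrame_unitary {N : ℕ} (i : Fin N) : (graphFrame i)ᴴ * graphFrame i = 1 := by
  have h2 := inv_sqrt_two_mul_self
  have h3 : conj (2 : ℂ) = 2 := map_ofNat _ 2
  rw [graphFrame]
  split_ifs
  · ext a b
    fin_cases a <;> fin_cases b <;> simp [Matrix.mul_apply, Matrix.conjTranspose_apply, h3] <;>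
      ring_nf <;> simp <;> ring_nf
  · ext a b
    have hc : conj ((1 / √2 : ℝ) : ℂ) = ((1 / √2 : ℝ) : ℂ) := Complex.conj_ofReal _
    generalize ((1 / √2 : ℝ) : ℂ) = r at *
    fin_cases a <;> fin_cases b <;>
      simp [Matrix.mul_apply, Matrix.conjTranspose_apply, hc] <;>
      first
      | linear_combination (2 : ℂ) * h2 - (r * r) * Complex.I_mul_I
      | linear_combination (r * r) * Complex.I_mul_I

theorem graphObs_mul_graphFrame {N : ℕ} (s ε : ℤˣ) (i : Fin N) (x : Fin 2) :
    graphObs s ε i x * graphFrame i = graphFrame i * ghzObs s ε i x := by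
  rw [graphObs, ghzObs, graphFrame, smul_mul_assoc, mul_smul_comm]
  congr 1
  split_ifs
  · rw [smul_mul_assoc, mul_smul_comm]
    ext a b
    fin_cases a <;> fin_cases b <;> simp [Matrix.mul_apply, σx, σy, σz] <;> ring_nf <;> simp <;>
      ring_nf
  · rw [smul_mul_assoc, mul_smul_comm]
    ext a b
    fin_cases a <;> fin_cases b <;> simp [Matrix.mul_apply, σx, σy, σz] <;> ring_nf <;> simp <;>
      ring_nf
  · ext a b
    fin_cases a <;> fin_cases b <;> simp [Matrix.mul_apply, σx, σz]
  · ext a b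
    fin_cases a <;> fin_cases b <;> simp [Matrix.mul_apply, σx, σy, mul_assoc]

theorem qubitApply_ghz {N : ℕ} (B : Fin N → Matrix (Fin 2) (Fin 2) ℂ) (g : Bits N) :
    qubitApply B (ghz N) g = (∏ i, B i (g i) 0 + ∏ i, B i (g i) 1) / (√2 : ℝ) := by
  simp only [qubitApply, ghz, ← funext_iff, mul_div_assoc', mul_add, mul_ite, mul_one, mul_zero,
    ← Finset.sum_div, Finset.sum_add_distrib, Finset.sum_ite_eq', Finset.mem_univ, if_true]

theorem graphFrame_apply_zero {N : ℕ} (i : Fin N) (a : Fin 2) :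
    graphFrame i a 0 =
      (if (i : ℕ) = 0 then (1 - Complex.I) / 2 else ((1 / √2 : ℝ) : ℂ)) * Complex.I ^ (a : ℕ) := by
  rw [graphFrame]
  split_ifs <;> fin_cases a <;> simp

theorem graphFrame_apply_one {N : ℕ} (i : Fin N) (a : Fin 2) :
    graphFrame i a 1 = (if (i : ℕ) = 0 then (1 - Complex.I) / 2 * Complex.I
      else ((1 / √2 : ℝ) : ℂ)) * (-Complex.I) ^ (a : ℕ) := by
  rw [graphFrame]
  split_ifs <;> fin_cases a <;> simp [mul_assoc]

/-- Both sides change sign under `w ↦ w + 2`. The two powers are the contributions of `0⋯0` and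
`1⋯1` to a graph state amplitude. -/
theorem graph_phase_identity (w : ℕ) :
    (1 - Complex.I) / 2 * (Complex.I ^ w + Complex.I * (-Complex.I) ^ w) =
      (-1) ^ w.choose 2 := by
  induction w using Nat.twoStepInduction with
  | zero => norm_num; linear_combination (-1 / 2 : ℂ) * Complex.I_mul_I
  | one => norm_num; linear_combination (-1 / 2 : ℂ) * Complex.I_mul_I
  | more w ih _ =>
    have h : (w + 2).choose 2 = w.choose 2 + 2 * w + 1 := by
      simp [Nat.choose_succ_succ]; ring
    have h1 : Complex.I ^ (w + 2) = -Complex.I ^ w := by rw [pow_add, Complex.I_sq]; ring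
    have h2 : (-Complex.I) ^ (w + 2) = -(-Complex.I) ^ w := by
      rw [pow_add, neg_sq, Complex.I_sq]; ring
    have h3 : (-1 : ℂ) ^ (w.choose 2 + 2 * w + 1) = -(-1) ^ w.choose 2 := by
      rw [pow_succ, pow_add, pow_mul]; simp
    rw [h, h1, h2, h3]
    linear_combination -ih

theorem qubitApply_graphFrame {n : ℕ} :
    qubitApply graphFrame (ghz (n + 1)) = graphState (n + 1) := by
  ext g
  have hs : √((2 : ℝ) ^ (n + 1)) = √2 ^ (n + 1) := by
    rw [Real.sqrt_eq_iff_mul_self_eq (by positivity) (by positivity), ← mul_pow,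
      Real.mul_self_sqrt (by norm_num)]
  rw [qubitApply_ghz, graphState, ← graph_phase_identity, hs]
  simp only [graphFrame_apply_zero, graphFrame_apply_one, Finset.prod_mul_distrib,
    Finset.prod_pow_eq_pow_sum]
  simp only [Fin.prod_univ_succ (n := n)]
  simp [weight]
  ring

theorem selfTests_graphState {n : ℕ} (hn : n ≠ 0) {s ε : ℤˣ} {p : Behaviour (n + 1)}
    (hp : svetlichny s p = ((ε : ℤ) : ℝ) * (2 ^ n * √2)) :
    SelfTests.{u} p (graphState (n + 1)) (graphObs s ε) :=
  selfTests_of_frame hn hp graphFrame_unitary qubitApply_graphFrame (graphObs_mul_graphFrame s ε)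

end SelfTest

/-! ### The Svetlichny value of the reference experiment. -/

section Reference

variable {N : ℕ}

theorem qubitApply_sum {α : Type*} [Fintype α] (c : Fin N → α → ℂ)
    (M : Fin N → α → Matrix (Fin 2) (Fin 2) ℂ) (Φ : Qubits N) (g : Bits N) :
    qubitApply (fun i => ∑ a, c i a • M i a) Φ g =
      ∑ a : Fin N → α, (∏ i, c i (a i)) * qubitApply (fun i => M i (a i)) Φ g := by
  classical
  simp only [qubitApply, Matrix.sum_apply, Matrix.smul_apply, smul_eq_mul, Finset.prod_univ_sum,
    Fintype.piFinset_univ, Finset.prod_mul_distrib, Finset.sum_mul, Finset.mul_sum, mul_assoc]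
  rw [Finset.sum_comm]

/-- Each observable is the signed sum of its two outcome operators; expanding the tensor product
gives the signed sum over outputs. -/
theorem correlator_refBehaviour (Φ : Qubits N) (B : Fin N → Fin 2 → Matrix (Fin 2) (Fin 2) ℂ)
    (x : Bits N) : correlator (refBehaviour Φ B) x =
      (∑ g, conj (Φ g) * qubitApply (fun i => B i (x i)) Φ g).re := by
  have h1 : (fun i => B i (x i)) = fun i => ∑ a : Fin 2, (-1 : ℂ) ^ (a : ℕ) •
      ((1 / 2 : ℂ) • (1 + (-1 : ℂ) ^ (a : ℕ) • B i (x i))) := by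
    ext1 i
    simp only [Fin.sum_univ_two, Fin.val_zero, Fin.val_one, pow_zero, pow_one]
    module
  rw [correlator_eq_sum, h1]
  simp only [refBehaviour, qubitApply_sum, Finset.mul_sum, Finset.prod_pow_eq_pow_sum]
  rw [Finset.sum_comm, Complex.re_sum]
  refine Finset.sum_congr rfl fun a _ => ?_
  rw [← Complex.re_ofReal_mul, Finset.mul_sum]
  congr 1
  refine Finset.sum_congr rfl fun g _ => ?_
  rw [weight]
  push_cast
  ring

theorem sum_conj_ghz_mul (F : Qubits N) :
    ∑ g, conj (ghz N g) * F g = (F (fun _ => 0) + F fun _ => 1) / (√2 : ℝ) := by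
  have h : ∀ g, conj (ghz N g) * F g = (if g = fun _ => 0 then F g / (√2 : ℝ) else 0) +
      if g = fun _ => 1 then F g / (√2 : ℝ) else 0 := by
    intro g
    simp only [ghz, ← funext_iff, map_div₀, map_add, Complex.conj_ofReal, apply_ite conj, map_one,
      map_zero]
    split_ifs <;> ring
  simp only [h, Finset.sum_add_distrib, Finset.sum_ite_eq', Finset.mem_univ, if_true]
  ring

theorem ghzObs_apply_zero_one (s ε : ℤˣ) (i : Fin N) (x : Fin 2) :
    ghzObs s ε i x 0 1 = targetSign s ε i x *
      ((if (i : ℕ) = 0 then ((1 / √2 : ℝ) : ℂ) * (1 - Complex.I) else 1) *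
        (-Complex.I) ^ (x : ℕ)) := by
  rw [ghzObs, Matrix.smul_apply, smul_eq_mul]
  congr 1
  split_ifs <;> fin_cases x <;> simp_all [σx, σy] <;> ring_nf <;> simp <;> ring_nf

theorem ghzObs_apply_one_zero (s ε : ℤˣ) (i : Fin N) (x : Fin 2) :
    ghzObs s ε i x 1 0 = targetSign s ε i x *
      ((if (i : ℕ) = 0 then ((1 / √2 : ℝ) : ℂ) * (1 + Complex.I) else 1) *
        Complex.I ^ (x : ℕ)) := by
  rw [ghzObs, Matrix.smul_apply, smul_eq_mul]
  congr 1
  split_ifs <;> fin_cases x <;> simp_all [σx, σy] <;> ring_nf <;> simp <;> ring_nf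

theorem ghzObs_apply_self (s ε : ℤˣ) (i : Fin N) (x a : Fin 2) : ghzObs s ε i x a a = 0 := by
  rw [ghzObs]
  split_ifs <;> fin_cases a <;> simp [σx, σy]

/-- The left side is twice the real part of `(1 + i) i ^ w`, whose sign pattern of period 4 is that
of the Svetlichny coefficients; this is why the first party's observables are rotated. -/
theorem svetlichnySign_identity (w : ℕ) :
    (1 - Complex.I) * (-Complex.I) ^ w + (1 + Complex.I) * Complex.I ^ w =
      2 * (svetlichnySign w : ℂ) := by
  induction w using Nat.twoStepInduction with
  | zero => norm_num [svetlichnySign]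
  | one =>
    norm_num [svetlichnySign]
    linear_combination 2 * Complex.I_mul_I
  | more w ih _ =>
    have h1 : Complex.I ^ (w + 2) = -Complex.I ^ w := by rw [pow_add, Complex.I_sq]; ring
    have h2 : (-Complex.I) ^ (w + 2) = -(-Complex.I) ^ w := by
      rw [pow_add, neg_sq, Complex.I_sq]; ring
    have h3 : svetlichnySign (w + 2) = -svetlichnySign w := by
      have h := svetlichnySign_mul_succ w
      have h' := svetlichnySign_mul_succ (w + 1)
      rw [pow_succ, ← h] at h'
      have hs := svetlichnySign_mul_self (w + 1)
      linear_combination svetlichnySign (w + 1) * h' - (svetlichnySign (w + 2) + svetlichnySign w) * hs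
    rw [h1, h2, h3]
    push_cast
    linear_combination -ih

theorem correlator_ghz {n : ℕ} (s ε : ℤˣ) (x : Bits (n + 1)) :
    correlator (refBehaviour (ghz (n + 1)) (ghzObs s ε)) x =
      ((s : ℤ) : ℝ) ^ weight x * ((ε : ℤ) : ℝ) * svetlichnySign (weight x) * (1 / √2) := by
  have h2 := inv_sqrt_two_mul_self
  have key : ∑ g, conj (ghz (n + 1) g) * qubitApply (fun i => ghzObs s ε i (x i)) (ghz (n + 1)) g =
      ((((s : ℤ) : ℝ) ^ weight x * ((ε : ℤ) : ℝ) * svetlichnySign (weight x) * (1 / √2) : ℝ) : ℂ)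
      := by
    rw [sum_conj_ghz_mul, qubitApply_ghz, qubitApply_ghz]
    simp only [ghzObs_apply_self, ghzObs_apply_zero_one, ghzObs_apply_one_zero,
      Finset.prod_mul_distrib, prod_targetSign, Finset.prod_pow_eq_pow_sum]
    simp only [Fin.prod_univ_succ (n := n), Fin.val_zero, Fin.val_succ, if_true,
      Nat.add_eq_zero_iff, one_ne_zero, and_false, if_false, Finset.prod_const_one, mul_one,
      zero_mul, zero_add, add_zero]
    change (((s : ℤ) : ℂ) ^ weight x * _ * (_ * (-Complex.I) ^ weight x) / _ +
      ((s : ℤ) : ℂ) ^ weight x * _ * (_ * Complex.I ^ weight x) / _) / _ = _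
    have h := svetlichnySign_identity (weight x)
    push_cast at h2 ⊢
    linear_combination (((s : ℤ) : ℂ) ^ weight x * ((ε : ℤ) : ℂ) / 2 * (1 / (√2 : ℝ))) * h +
      (((s : ℤ) : ℂ) ^ weight x * ((ε : ℤ) : ℂ) * (1 / (√2 : ℝ)) * ((1 - Complex.I) *
        (-Complex.I) ^ weight x + (1 + Complex.I) * Complex.I ^ weight x)) * h2
  rw [correlator_refBehaviour, key, Complex.ofReal_re]

theorem svetlichny_ghz {n : ℕ} (s ε : ℤˣ) :
    svetlichny s (refBehaviour (ghz (n + 1)) (ghzObs s ε)) =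
      ((ε : ℤ) : ℝ) * (2 ^ n * √2) := by
  have h2 : √2 * √2 = 2 := Real.mul_self_sqrt (by norm_num)
  have hs : ((s : ℤ) : ℝ) * ((s : ℤ) : ℝ) = 1 := by
    rcases Int.units_eq_one_or s with rfl | rfl <;> simp
  have h : ∀ x : Bits (n + 1), (-1 : ℝ) ^ (((weight x : ℤ) * ((weight x : ℤ) + (s : ℤ))) / 2) *
      correlator (refBehaviour (ghz (n + 1)) (ghzObs s ε)) x = ((ε : ℤ) : ℝ) * (1 / √2) := by
    intro x
    have h3 : ((s : ℤ) : ℝ) ^ weight x * ((s : ℤ) : ℝ) ^ weight x = 1 := by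
      rw [← mul_pow, hs, one_pow]
    have h4 := svetlichnySign_mul_self (weight x)
    rw [zpow_div_two_eq, correlator_ghz]
    linear_combination (((ε : ℤ) : ℝ) * (1 / √2)) * h3 * (svetlichnySign (weight x) *
      svetlichnySign (weight x)) + (((ε : ℤ) : ℝ) * (1 / √2)) * h4
  rw [svetlichny, Finset.sum_congr rfl fun x _ => h x]
  simp only [Finset.sum_const, Finset.card_univ, Fintype.card_fun, Fintype.card_fin, nsmul_eq_mul,
    Nat.cast_pow, Nat.cast_ofNat]
  field_simp
  rw [sq, h2]
  ring

end Reference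

/-! ### The reference behaviour is quantum. -/

section QubitOperators

open Classical in
/-- The matrix unit `|k⟩⟨l|` on `ℓ²` of two labels. -/
def qubitUnit (k l : Fin 2) : Ell2 (ULift.{u} (Fin 2)) →L[ℂ] Ell2 (ULift.{u} (Fin 2)) :=
  (lp.evalCLM ℂ (fun _ : ULift.{u} (Fin 2) => ℂ) 2 ⟨l⟩).smulRight (lp.single 2 ⟨k⟩ (1 : ℂ))

theorem qubitUnit_apply (k l : Fin 2) (v : Ell2 (ULift.{u} (Fin 2))) (g : ULift.{u} (Fin 2)) :
    qubitUnit k l v g = v ⟨l⟩ * if g.down = k then 1 else 0 := by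
  have h : ∀ w : Ell2 (ULift.{u} (Fin 2)),
      ((lp.evalCLM ℂ (fun _ : ULift.{u} (Fin 2) => ℂ) 2 ⟨l⟩).smulRight w v) g = v ⟨l⟩ * w g :=
    fun w => rfl
  rw [qubitUnit, h, coe_single_one (dec := Classical.propDecidable _)]
  simp only [ULift.ext_iff]

theorem matElem_qubitUnit (k l : Fin 2) (g f : ULift.{u} (Fin 2)) :
    matElem (qubitUnit k l) g f = if g.down = k ∧ l = f.down then 1 else 0 := by
  rw [matElem, qubitUnit_apply, coe_single_one (dec := Classical.propDecidable _)]
  simp only [ULift.ext_iff]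
  split_ifs <;> simp_all

/-- The operator on `ℓ²` of two labels given by a matrix. -/
def qubitOp (M : Matrix (Fin 2) (Fin 2) ℂ) :
    Ell2 (ULift.{u} (Fin 2)) →L[ℂ] Ell2 (ULift.{u} (Fin 2)) :=
  ∑ g, ∑ f, M g f • qubitUnit g f

theorem matElem_qubitOp (M : Matrix (Fin 2) (Fin 2) ℂ) (g f : ULift.{u} (Fin 2)) :
    matElem (qubitOp M) g f = M g.down f.down := by
  have h : matElem (qubitOp M) g f = ∑ k, ∑ l, M k l * matElem (qubitUnit k l) g f := by
    simp only [matElem, qubitOp, Fin.sum_univ_two]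
    rfl
  rw [h]
  simp only [matElem_qubitUnit]
  simp [ite_and]

theorem matElem_mul {κ : Type u} [Fintype κ] (A B : Ell2 κ →L[ℂ] Ell2 κ) (g f : κ) :
    matElem (A * B) g f = ∑ k, matElem A g k * matElem B k f := by
  classical
  exact (hasSum_matElem A _ g).unique (hasSum_fintype _)

theorem star_qubitOp (M : Matrix (Fin 2) (Fin 2) ℂ) : star (qubitOp.{u} M) = qubitOp Mᴴ :=
  ext_matElem fun g f => by
    rw [matElem_star, matElem_qubitOp, matElem_qubitOp, Matrix.conjTranspose_apply]; rfl

theorem qubitOp_mul (M M' : Matrix (Fin 2) (Fin 2) ℂ) :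
    qubitOp.{u} (M * M') = qubitOp M * qubitOp M' :=
  ext_matElem fun g f => by
    rw [matElem_mul, matElem_qubitOp, Matrix.mul_apply, ← Equiv.ulift.sum_comp]
    simp only [matElem_qubitOp]
    rfl

theorem qubitOp_add (M M' : Matrix (Fin 2) (Fin 2) ℂ) :
    qubitOp.{u} (M + M') = qubitOp M + qubitOp M' := by
  simp only [qubitOp, Matrix.add_apply, add_smul, Finset.sum_add_distrib]

theorem qubitOp_one : qubitOp.{u} 1 = 1 :=
  ext_matElem fun g f => by
    classical
    rw [matElem_qubitOp, matElem_one, Matrix.one_apply]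
    simp only [ULift.ext_iff]

theorem isPositive_qubitOp {M : Matrix (Fin 2) (Fin 2) ℂ} (hM : Mᴴ = M) (hMM : M * M = M) :
    (qubitOp.{u} M).IsPositive := by
  rw [← ContinuousLinearMap.nonneg_iff_isPositive, ← hMM, qubitOp_mul]
  nth_rw 1 [← hM]
  rw [← star_qubitOp]
  exact star_mul_self_nonneg _

variable {N : ℕ} {Φ : Qubits N} {B : Fin N → Fin 2 → Matrix (Fin 2) (Fin 2) ℂ}

/-- The labels of the product basis of `N` qubits. -/
def bitsEquiv (N : ℕ) : Bits N ≃ (Fin N → ULift.{u} (Fin 2)) × PUnit.{u + 1} :=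
  (Equiv.arrowCongr (Equiv.refl _) Equiv.ulift.symm).trans (Equiv.prodPUnit _).symm

/-- The realization given by a state of `N` qubits and involutive observables. -/
def qubitRealization (hΦ : ∑ g, ‖Φ g‖ ^ 2 = 1) (hB : ∀ i x, (B i x)ᴴ = B i x)
    (hBB : ∀ i x, B i x * B i x = 1) : Realization.{u} N where
  ι _ := ULift (Fin 2)
  P := PUnit
  ψ := ⟨fun z => Φ ((bitsEquiv N).symm z), memℓp_two_of_summable Summable.of_finite⟩
  norm_ψ := by
    have h := (hasSum_norm_sq (κ := (Fin N → ULift.{u} (Fin 2)) × PUnit.{u + 1})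
      ⟨fun z => Φ ((bitsEquiv N).symm z), memℓp_two_of_summable Summable.of_finite⟩).unique
        (hasSum_fintype _)
    rw [← (bitsEquiv N).sum_comp] at h
    simp only [Equiv.symm_apply_apply, hΦ] at h
    exact (pow_eq_one_iff_of_nonneg (norm_nonneg _) two_ne_zero).1 h
  E i x a := qubitOp ((1 / 2 : ℂ) • (1 + (-1 : ℂ) ^ (a : ℕ) • B i x))
  E_pos i x a := by
    have h1 : ((-1 : ℂ) ^ (a : ℕ)) * ((-1 : ℂ) ^ (a : ℕ)) = 1 := by
      rw [← mul_pow]; simp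
    refine isPositive_qubitOp ?_ ?_
    · have h2 : star ((-1 : ℂ) ^ (a : ℕ)) = (-1 : ℂ) ^ (a : ℕ) := by simp
      have h3 : star (1 / 2 : ℂ) = 1 / 2 := by simp
      rw [Matrix.conjTranspose_smul, Matrix.conjTranspose_add, Matrix.conjTranspose_smul,
        Matrix.conjTranspose_one, hB, h2, h3]
    · rw [smul_mul_smul_comm, add_mul, mul_add, mul_add, smul_mul_smul_comm, hBB, h1]
      simp only [one_mul, mul_one]
      module
  E_sum i x := by
    rw [← qubitOp_add, ← qubitOp_one]
    congr 1
    simp only [Fin.val_zero, Fin.val_one, pow_zero, pow_one]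
    module

/-- `refBehaviour` keeps only a real part, whereas the Born rule in `Compatible` is an equation of
complex numbers; hermiticity closes the gap. -/
theorem conj_sum_conj_mul_qubitApply {M : Fin N → Matrix (Fin 2) (Fin 2) ℂ}
    (hM : ∀ i, (M i)ᴴ = M i) : conj (∑ g, conj (Φ g) * qubitApply M Φ g) =
      ∑ g, conj (Φ g) * qubitApply M Φ g := by
  have h : ∀ i a b, conj (M i a b) = M i b a := fun i a b => by
    conv_rhs => rw [← hM i]
    rfl
  simp only [qubitApply, map_sum, map_mul, map_prod, Complex.conj_conj, Finset.mul_sum, h]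
  rw [Finset.sum_comm]
  refine Finset.sum_congr rfl fun g _ => Finset.sum_congr rfl fun f _ => ?_
  ring

theorem isQuantum_refBehaviour (hΦ : ∑ g, ‖Φ g‖ ^ 2 = 1) (hB : ∀ i x, (B i x)ᴴ = B i x)
    (hBB : ∀ i x, B i x * B i x = 1) : IsQuantum.{u} (refBehaviour Φ B) := by
  refine ⟨qubitRealization hΦ hB hBB, fun a x => ?_⟩
  set M : Fin N → Matrix (Fin 2) (Fin 2) ℂ :=
    fun i => (1 / 2 : ℂ) • (1 + (-1 : ℂ) ^ (a i : ℕ) • B i (x i)) with hM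
  have hM' : ∀ i, (M i)ᴴ = M i := fun i => by
    have h2 : star ((-1 : ℂ) ^ (a i : ℕ)) = (-1 : ℂ) ^ (a i : ℕ) := by simp
    have h3 : star (1 / 2 : ℂ) = 1 / 2 := by simp
    rw [hM, Matrix.conjTranspose_smul, Matrix.conjTranspose_add, Matrix.conjTranspose_smul,
      Matrix.conjTranspose_one, hB, h2, h3]
  have h1 : ∀ g : Bits N, tensorApply (fun i => qubitOp.{u} (M i))
      (fun z => Φ ((bitsEquiv N).symm z)) (bitsEquiv N g) = qubitApply M Φ g := fun g => by
    rw [tensorApply, tsum_fintype, qubitApply,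
      ← (Equiv.arrowCongr (Equiv.refl _) Equiv.ulift.symm).sum_comp]
    simp only [matElem_qubitOp]
    rfl
  refine (Complex.conj_eq_iff_re.1 (conj_sum_conj_mul_qubitApply hM')).trans ?_
  change _ = ∑' z : (Fin N → ULift.{u} (Fin 2)) × PUnit.{u + 1},
    conj (Φ ((bitsEquiv N).symm z)) *
      tensorApply (fun i => qubitOp.{u} (M i)) (fun z => Φ ((bitsEquiv N).symm z)) z
  rw [tsum_fintype, ← (bitsEquiv N).sum_comp]
  simp only [h1, Equiv.symm_apply_apply]

theorem ghzObs_conjTranspose (s ε : ℤˣ) (i : Fin N) (x : Fin 2) :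
    (ghzObs s ε i x)ᴴ = ghzObs s ε i x := by
  have hx : σxᴴ = σx := by ext a b; fin_cases a <;> fin_cases b <;> simp [σx]
  have hy : σyᴴ = σy := by ext a b; fin_cases a <;> fin_cases b <;> simp [σy]
  have hr : star ((1 / √2 : ℝ) : ℂ) = ((1 / √2 : ℝ) : ℂ) := Complex.conj_ofReal _
  have ht : star (targetSign s ε i x) = targetSign s ε i x := by
    rcases targetSign_eq_one_or s ε i x with h | h <;> simp [h]
  rw [ghzObs, Matrix.conjTranspose_smul, ht]
  split_ifs <;> simp only [Matrix.conjTranspose_smul, Matrix.conjTranspose_add,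
    Matrix.conjTranspose_sub, hx, hy, hr]

theorem ghzObs_mul_self (s ε : ℤˣ) (i : Fin N) (x : Fin 2) :
    ghzObs s ε i x * ghzObs s ε i x = 1 := by
  have hx : σx * σx = 1 := by
    ext a b; fin_cases a <;> fin_cases b <;> simp [σx]
  have hy : σy * σy = 1 := by
    ext a b; fin_cases a <;> fin_cases b <;> simp [σy]
  have hyx : σy * σx = -(σx * σy) := by
    ext a b; fin_cases a <;> fin_cases b <;> simp [σx, σy]
  rw [ghzObs, smul_mul_smul_comm, targetSign_mul_self, one_smul]
  split_ifs
  · rw [smul_mul_smul_comm, inv_sqrt_two_mul_self, add_mul, mul_add, mul_add, hx, hy, hyx]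
    module
  · rw [smul_mul_smul_comm, inv_sqrt_two_mul_self, sub_mul, mul_sub, mul_sub, hx, hy, hyx]
    module
  · exact hx
  · exact hy

end QubitOperators

end SvetlichnySelfTest

end

theorem corollary1 (N : ℕ) (hN : 2 ≤ N) (s : ℤˣ) :
    -- the maximal quantum value of `|S_N^s|`
    (∀ p : SvetlichnySelfTest.Behaviour N, SvetlichnySelfTest.IsQuantum.{u} p →
      |SvetlichnySelfTest.svetlichny s p| ≤ 2 ^ (N - 1) * √2) ∧
    -- for each sign `ε` with which this value can be attained
    ∀ ε : ℤˣ,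
      -- the GHZ state with its Pauli observables attains it
      (SvetlichnySelfTest.IsQuantum.{u} (SvetlichnySelfTest.refBehaviour
          (SvetlichnySelfTest.ghz N) (SvetlichnySelfTest.ghzObs s ε)) ∧
        SvetlichnySelfTest.svetlichny s (SvetlichnySelfTest.refBehaviour
          (SvetlichnySelfTest.ghz N) (SvetlichnySelfTest.ghzObs s ε)) =
            ((ε : ℤ) : ℝ) * (2 ^ (N - 1) * √2)) ∧
      -- and every behaviour that attains it self-tests the GHZ state and these observables,
      -- also in the local frame in which the GHZ state is the fully connected graph state
      ∀ p : SvetlichnySelfTest.Behaviour N,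
        SvetlichnySelfTest.svetlichny s p = ((ε : ℤ) : ℝ) * (2 ^ (N - 1) * √2) →
          SvetlichnySelfTest.SelfTests.{u} p (SvetlichnySelfTest.ghz N)
            (SvetlichnySelfTest.ghzObs s ε) ∧
          SvetlichnySelfTest.SelfTests.{u} p (SvetlichnySelfTest.graphState N)
            (SvetlichnySelfTest.graphObs s ε) := by
  obtain ⟨n, rfl⟩ : ∃ n, N = n + 1 := ⟨N - 1, by omega⟩
  have hn : n ≠ 0 := by omega
  rw [Nat.add_sub_cancel]
  exact ⟨fun p hp => SvetlichnySelfTest.abs_svetlichny_le hn s hp, fun ε =>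
    ⟨⟨SvetlichnySelfTest.isQuantum_refBehaviour (SvetlichnySelfTest.sum_norm_ghz_sq n.succ_ne_zero) (SvetlichnySelfTest.ghzObs_conjTranspose s ε)
      (SvetlichnySelfTest.ghzObs_mul_self s ε), SvetlichnySelfTest.svetlichny_ghz s ε⟩,
      fun p hp => ⟨SvetlichnySelfTest.selfTests_ghz hn hp, SvetlichnySelfTest.selfTests_graphState hn hp⟩⟩⟩
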